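/- Let $\mathbb T=\mathbb R/\mathbb Z$, let $\pi:\mathbb R\to\mathbb T$ be the projection, and let $F:\mathbb T\to\mathbb R$ be continuous, regarded also as a $1$-periodic function on $\mathbb R$. For $x\in\mathbb R$ put $$S(x)=\int_0^xF(s)\,ds,\qquad \Phi(x)=\min_{y\in[x,x+1]}\bigl(S(x)-S(y)\bigr)=-\max_{y\in[x,x+1]}\bigl(S(y)-S(x)\bigr).$$ **Definition of $W$.** Put $F_+=\max(F,0)$, $F_-=|\min(F,0)|$. For $x\ne y$ in $\mathbb T$ let $V_+(x,y)$ be the integral of $F_+$ along the arc from $x$ to $y$ in the direction of increasing parameter, and $V_-(x,y)$ the integral of $F_-$ (with respect to arc length) along the arc from $x$ to $y$ in the opposite direction; put $V_\pm(x,x)=0$ and $V(x,y)=\min\{V_+(x,y),V_-(x,y)\}$. A connected component of $\{x\in\mathbb T:F(x)=0\}$ is called stable if it is $\pi([a,b])$ for some $a\le b$ and there is $\varepsilon>0$ such that $F<0$ on $[a-\varepsilon,a)$ and $F>0$ on $(b,b+\varepsilon]$. Suppose that $\{F=0\}\subset\mathbb T$ has finitely many connected components, and let $K_1,\dots,K_\ell$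 be the stable ones. For a component $K$ of $\{F=0\}$ and $x\in\mathbb T$, $V(y,x)$ does not depend on $y\in K$ and is denoted by $V(K,x)$; for two components $K,K'$, $V(K,x)$ does not depend on $x\in K'$ and is denoted by $V(K,K')$. Let $G\{i\}$ be the set of directed trees with vertex set $\{1,\dots,\ell\}$, rooted at $i$ and pointing towards the root (every $j\neq i$ is the initial point of exactly one arrow, from every $j\ne i$ a sequence of arrows leads to $i$, and no arrow exits from $i$). Put $$W(K_i)=\min_{g\in G\{i\}}\ \sum_{(m\to n)\in g}V(K_m,K_n),\qquad W(x)=\min_{1\le i\le\ell}\bigl[W(K_i)+V(K_i,x)\bigr]\quad(x\in\mathbb T),$$ and $W\equiv0$ if $\ell=0$. This is the Freidlin–Wentzell function for the drift $b=-F/2$ on $\mathbb T$. **Theorem.** (i) $\Phi$ is Lipschitz continuous and $1$-periodic. - If $S$ is monotone (nondecreasing or nonincreasing), then $\Phi$ is constant, equal to $\min\{0,-S(1)\}$. - If $S(1)=0$, then $S$ is $1$-periodic and $\Phi=S$ up to an additive constant. - If $S(1)\neq0$ and $S$ is not monotone, then the set $U=\{x\in\mathbb R:\Phi(x)\ne\min\{0,-S(1)\}\}$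 is open and $\mathbb R\setminus U$ has nonempty interior. On each connected component of $U$, $\Phi=S$ up to an additive constant; more precisely, $\Phi(x)=S(x)-S(a)+\Phi(a)$ for all $x\in(a,b)$ whenever $(a,b)\subset U$. On $\mathbb R\setminus U$, $\Phi$ is constant, equal to $\min\{0,-S(1)\}$, and reaches its maximum there: $$\max_{x\in[0,\infty)}\Phi(x)=\max_{x\in[0,1]}\Phi(x)=\min\{0,-S(1)\}.$$ (ii) If $\{x\in\mathbb T:F(x)=0\}$ has finitely many connected components, then for all $x\in\mathbb R$ $$\Phi(x)-\min_{x'\in[0,1]}\Phi(x')=W(\pi(x))-\min_{y\in\mathbb T}W(y).$$ -/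

import Mathlib

/-! Objects attached to a continuous function `F` on the circle `𝕋 = ℝ / ℤ` (`UnitAddCircle`).
For `s : ℝ`, the value `F (s : 𝕋)` is that of the `1`-periodic function on `ℝ` given by `F`. -/

noncomputable section

namespace CircleLD

/-- `S(x) = ∫₀ˣ F(s) ds`. -/
def S (F : UnitAddCircle → ℝ) (x : ℝ) : ℝ :=
  ∫ s in (0 : ℝ)..x, F (s : UnitAddCircle)

/-- `Φ(x) = min_{y ∈ [x, x+1]} (S(x) - S(y))`; for continuous `F` the infimum is attained, see
`isLeast_Phi`. -/
def Phi (F : UnitAddCircle → ℝ) (x : ℝ) : ℝ :=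
  sInf ((fun y : ℝ => S F x - S F y) '' Set.Icc x (x + 1))

/-- `U = {x ∈ ℝ : Φ(x) ≠ min {0, -S(1)}}`. -/
def U (F : UnitAddCircle → ℝ) : Set ℝ :=
  {x : ℝ | Phi F x ≠ min 0 (-S F 1)}

theorem continuous_S {F : UnitAddCircle → ℝ} (hF : Continuous F) : Continuous (S F) :=
  intervalIntegral.continuous_primitive
    (fun a b => (hF.comp (AddCircle.continuous_mk' 1)).intervalIntegrable a b) 0

theorem isLeast_Phi {F : UnitAddCircle → ℝ} (hF : Continuous F) (x : ℝ) :
    IsLeast ((fun y : ℝ => S F x - S F y) '' Set.Icc x (x + 1)) (Phi F x) :=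
  (isCompact_Icc.image (continuous_const.sub (continuous_S hF))).isLeast_sInf
    ((Set.nonempty_Icc.2 (by linarith)).image _)

/-- `-Φ(x) = max_{y ∈ [x, x+1]} (S(y) - S(x))`. -/
theorem isGreatest_neg_Phi {F : UnitAddCircle → ℝ} (hF : Continuous F) (x : ℝ) :
    IsGreatest ((fun y : ℝ => S F y - S F x) '' Set.Icc x (x + 1)) (-Phi F x) := by
  obtain ⟨⟨y, hy, hxy⟩, hlow⟩ := isLeast_Phi hF x
  refine ⟨⟨y, hy, ?_⟩, ?_⟩
  · simp only at hxy ⊢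
    linarith
  · rintro _ ⟨z, hz, rfl⟩
    have h := hlow ⟨z, hz, rfl⟩
    simp only at h ⊢
    linarith

/-- Positive part `F₊ = F ∨ 0`. -/
def posPart (F : UnitAddCircle → ℝ) (x : UnitAddCircle) : ℝ := max (F x) 0

/-- Negative part `F₋ = |F ∧ 0|`. -/
def negPart (F : UnitAddCircle → ℝ) (x : UnitAddCircle) : ℝ := |min (F x) 0|

/-- The representative in `[0, 1)` of a point of the circle. -/
def rep (x : UnitAddCircle) : ℝ := (AddCircle.equivIco (1 : ℝ) 0 x : ℝ)

/-- Integral of `h` along the path going from `x` to `y` clockwise, that is, in the direction in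
which the projection of `t` moves when `t` increases; the path is the point `{x}` if `x = y`. -/
def integralCW (h : UnitAddCircle → ℝ) (x y : UnitAddCircle) : ℝ :=
  if rep x < rep y then ∫ s in (rep x)..(rep y), h (s : UnitAddCircle)
  else if rep y < rep x then ∫ s in (rep x)..(rep y + 1), h (s : UnitAddCircle)
  else 0

/-- Integral of `h` along the (unoriented) path connecting `x` to `y` anticlockwise. -/
def integralCCW (h : UnitAddCircle → ℝ) (x y : UnitAddCircle) : ℝ :=
  if rep y < rep x then ∫ s in (rep y)..(rep x), h (s : UnitAddCircle)
  else if rep x < rep y then ∫ s in (rep y)..(rep x + 1), h (s : UnitAddCircle)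
  else 0

/-- `V₊(x, y)`, the integral of `F₊` along the clockwise path from `x` to `y`. -/
def VPlus (F : UnitAddCircle → ℝ) (x y : UnitAddCircle) : ℝ := integralCW (posPart F) x y

/-- `V₋(x, y)`, the integral of `F₋` along the anticlockwise path from `x` to `y`. -/
def VMinus (F : UnitAddCircle → ℝ) (x y : UnitAddCircle) : ℝ := integralCCW (negPart F) x y

/-- `V(x, y) = V₊(x, y) ∧ V₋(x, y)`. -/
def V (F : UnitAddCircle → ℝ) (x y : UnitAddCircle) : ℝ := min (VPlus F x y) (VMinus F x y)

/-- The connected components of `{x ∈ 𝕋 : F(x) = 0}`. -/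
def zeroComponents (F : UnitAddCircle → ℝ) : Set (Set UnitAddCircle) :=
  {C | ∃ x : UnitAddCircle, F x = 0 ∧ C = connectedComponentIn {z : UnitAddCircle | F z = 0} x}

/-- The stable connected components of `{F = 0}`: those of the form `[a, b]` with `F < 0`
immediately before `a` and `F > 0` immediately after `b`. -/
def stableComponents (F : UnitAddCircle → ℝ) : Set (Set UnitAddCircle) :=
  {C | C ∈ zeroComponents F ∧
    ∃ a b : ℝ, a ≤ b ∧ C = (fun s : ℝ => (s : UnitAddCircle)) '' Set.Icc a b ∧
      ∃ ε : ℝ, 0 < ε ∧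
        (∀ s ∈ Set.Ico (a - ε) a, F (s : UnitAddCircle) < 0) ∧
        (∀ s ∈ Set.Ioc b (b + ε), 0 < F (s : UnitAddCircle))}

/-- `V(A, B)` for sets of points. It is used only when `A` is a connected component of `{F = 0}`
and `B` is such a component or a single point; then `V(x, y)` has the same value for all `x ∈ A`
and `y ∈ B` (namely `0` if `A = B` or `B ⊆ A`), and this common value is the infimum. -/
def VSet (F : UnitAddCircle → ℝ) (A B : Set UnitAddCircle) : ℝ :=
  sInf (Set.image2 (V F) A B)

/-- The set `G{i}` of the directed trees with vertex set `ι`, rooted at `i` and pointing towards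
the root; a graph is given by the finite set of its arrows `(m, n)`, from `m` to `n`. -/
def rootedTrees (ι : Type*) (i : ι) : Set (Finset (ι × ι)) :=
  {g | (∀ j : ι, j ≠ i → ∃! n : ι, (j, n) ∈ g) ∧
    (∀ j : ι, j ≠ i → Relation.ReflTransGen (fun m n : ι => (m, n) ∈ g) j i) ∧
    (∀ n : ι, (i, n) ∉ g)}

/-- `W(K_i) = min_{g ∈ G{i}} ∑_{(m → n) ∈ g} V(K_m, K_n)`, the vertices being the stable
components themselves. -/
def WComp (F : UnitAddCircle → ℝ) (K : stableComponents F) : ℝ :=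
  sInf ((fun g : Finset (stableComponents F × stableComponents F) =>
      ∑ p ∈ g, VSet F (p.1 : Set UnitAddCircle) (p.2 : Set UnitAddCircle)) ''
    rootedTrees (stableComponents F) K)

open Classical in
/-- The Freidlin-Wentzell function `W` on the circle, for the drift `b = -F / 2`. It is `0` if there
is no stable component, and `W(x) = min_i [W(K_i) + V(K_i, x)]` otherwise. -/
def W (F : UnitAddCircle → ℝ) (x : UnitAddCircle) : ℝ :=
  if stableComponents F = ∅ then 0
  else ⨅ K : stableComponents F, (WComp F K + VSet F (K : Set UnitAddCircle) {x})

end CircleLD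

end

open Set Filter Topology

namespace CircleLD

variable {F : UnitAddCircle → ℝ}

/-! (i) The choices `y = x` and `y = x + 1` give Φ ≤ min{0, -S(1)}, and `U` is the set where the
maximum of S over the window [x, x+1] beats both end values. While the window slides through an
interval contained in `U`, one and the same point stays maximal, so Φ - S is constant there
(`Phi_sub_S_eq_of_Icc_subset_U`). Tilting S by half its mean slope produces an interval outside `U`
(`nonempty_interior_compl_U`).

(ii) Write S = P - N with P, N the primitives of F₊, F₋. On the line, moving right costs the
increase of P and moving left the decrease of N; V is the least cost over all lifts of the target.
Let t₀ < ⋯ < t_l = t₀ + 1 be the left ends of consecutive lifts of stable components. Between t_c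
and t_{c+1}, F cannot pass from negative to positive, so it is ≥ 0 up to some peak p and ≤ 0
afterwards. Every tree rooted at t₀ costs at least as much as the cycle with one edge cut, whose two
chains run to t₀ and to t_l (`exists_cut_le_tree`, `exists_tree_of_cut`): the bound is N(t_c) -
N(t₀) + P(t_l) - P(t_{c+1}). As N is constant on [t_c, p] and P on [p, t_{c+1}], this equals P(1) +
S(t₀) - S(p), and the best c gives W(K) = P(1) + Φ(t₀) (`WComp_eq`).

Finally Φ(x) ≤ Φ(y) + V(y, x) (`Phi_le_Phi_add_V`), and one of the two stable lifts around x
realizes equality, so W = Φ + P(1) (`exists_W_eq_Phi_add`). Without stable components S is monotone,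
and both functions are constant. -/

theorem continuous_lift (hF : Continuous F) : Continuous fun s : ℝ => F (s : UnitAddCircle) :=
  hF.comp (AddCircle.continuous_mk' 1)

theorem coe_add_int (x : ℝ) (k : ℤ) : ((x + k : ℝ) : UnitAddCircle) = (x : UnitAddCircle) := by
  have h : ((k : ℝ) : UnitAddCircle) = 0 := by
    rw [AddCircle.coe_eq_zero_iff]
    exact ⟨k, by simp⟩
  rw [AddCircle.coe_add, h, add_zero]

theorem coe_add_one (x : ℝ) : ((x + 1 : ℝ) : UnitAddCircle) = (x : UnitAddCircle) :=
  AddCircle.coe_add_period 1 x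

theorem exists_int_of_coe_eq {x y : ℝ} (h : (x : UnitAddCircle) = (y : UnitAddCircle)) :
    ∃ k : ℤ, x = y + k := by
  have h1 : ((x - y : ℝ) : UnitAddCircle) = 0 := by rw [AddCircle.coe_sub, h, sub_self]
  obtain ⟨k, hk⟩ := (AddCircle.coe_eq_zero_iff (p := (1 : ℝ))).1 h1
  refine ⟨k, ?_⟩
  rw [zsmul_eq_mul, mul_one] at hk
  linarith

/-! ### Calculus of the primitive `S`. -/

theorem S_zero (F : UnitAddCircle → ℝ) : S F 0 = 0 := intervalIntegral.integral_same

theorem S_sub (hF : Continuous F) (u v : ℝ) :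
    S F v - S F u = ∫ s in u..v, F (s : UnitAddCircle) :=
  intervalIntegral.integral_interval_sub_left
    ((continuous_lift hF).intervalIntegrable _ _) ((continuous_lift hF).intervalIntegrable _ _)

theorem S_add_one (hF : Continuous F) (x : ℝ) : S F (x + 1) = S F x + S F 1 := by
  have hper : Function.Periodic (fun s : ℝ => F (s : UnitAddCircle)) 1 := fun s => by
    simp only [coe_add_one]
  have h := hper.intervalIntegral_add_eq x 0
  rw [← S_sub hF, ← S_sub hF, S_zero, zero_add] at h
  linarith

theorem S_add_int (hF : Continuous F) (x : ℝ) (k : ℤ) : S F (x + k) = S F x + k * S F 1 := by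
  induction k using Int.induction_on with
  | zero => simp
  | succ i ih =>
    push_cast at ih ⊢
    rw [← add_assoc, S_add_one hF, ih]
    ring
  | pred i ih =>
    have h := S_add_one hF (x + ((-(i : ℤ) - 1 : ℤ) : ℝ))
    push_cast at ih h ⊢
    rw [show x + (-(i : ℝ) - 1) + 1 = x + -(i : ℝ) by ring, ih] at h
    linarith

theorem hasDerivAt_S (hF : Continuous F) (x : ℝ) : HasDerivAt (S F) (F (x : UnitAddCircle)) x :=
  intervalIntegral.integral_hasDerivAt_right ((continuous_lift hF).intervalIntegrable _ _)
    ((continuous_lift hF).stronglyMeasurableAtFilter _ _) (continuous_lift hF).continuousAt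

theorem exists_S_sub_eq (hF : Continuous F) {u v : ℝ} (huv : u < v) :
    ∃ ξ ∈ Ioo u v, S F v - S F u = F (ξ : UnitAddCircle) * (v - u) := by
  obtain ⟨ξ, hξ, h⟩ := exists_hasDerivAt_eq_slope (S F) (fun s : ℝ => F (s : UnitAddCircle)) huv
    (continuous_S hF).continuousOn fun x _ => hasDerivAt_S hF x
  refine ⟨ξ, hξ, ?_⟩
  rw [h]
  field_simp [sub_ne_zero.2 huv.ne']

theorem S_le_of_nonneg (hF : Continuous F) {u v : ℝ} (huv : u ≤ v)
    (h : ∀ s ∈ Ioo u v, 0 ≤ F (s : UnitAddCircle)) : S F u ≤ S F v := by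
  rcases huv.eq_or_lt with rfl | huv
  · rfl
  · obtain ⟨ξ, hξ, e⟩ := exists_S_sub_eq hF huv
    have := mul_nonneg (h ξ hξ) (sub_nonneg.2 huv.le)
    linarith

theorem S_le_of_nonpos (hF : Continuous F) {u v : ℝ} (huv : u ≤ v)
    (h : ∀ s ∈ Ioo u v, F (s : UnitAddCircle) ≤ 0) : S F v ≤ S F u := by
  rcases huv.eq_or_lt with rfl | huv
  · rfl
  · obtain ⟨ξ, hξ, e⟩ := exists_S_sub_eq hF huv
    have := mul_nonneg (neg_nonneg.2 (h ξ hξ)) (sub_nonneg.2 huv.le)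
    linarith

theorem S_eq_of_eq_zero (hF : Continuous F) {u v : ℝ} (huv : u ≤ v)
    (h : ∀ s ∈ Ioo u v, F (s : UnitAddCircle) = 0) : S F u = S F v :=
  le_antisymm (S_le_of_nonneg hF huv fun s hs => (h s hs).ge)
    (S_le_of_nonpos hF huv fun s hs => (h s hs).le)

theorem S_lt_of_pos (hF : Continuous F) {u v : ℝ} (huv : u < v)
    (h : ∀ s ∈ Ioo u v, 0 < F (s : UnitAddCircle)) : S F u < S F v := by
  obtain ⟨ξ, hξ, e⟩ := exists_S_sub_eq hF huv
  have := mul_pos (h ξ hξ) (sub_pos.2 huv)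
  linarith

theorem S_lt_of_neg (hF : Continuous F) {u v : ℝ} (huv : u < v)
    (h : ∀ s ∈ Ioo u v, F (s : UnitAddCircle) < 0) : S F v < S F u := by
  obtain ⟨ξ, hξ, e⟩ := exists_S_sub_eq hF huv
  have := mul_pos (neg_pos.2 (h ξ hξ)) (sub_pos.2 huv)
  linarith

/-! The function `Φ`. -/

theorem Phi_le (hF : Continuous F) {x y : ℝ} (hy : y ∈ Icc x (x + 1)) :
    Phi F x ≤ S F x - S F y :=
  (isLeast_Phi hF x).2 ⟨y, hy, rfl⟩

theorem exists_Phi_eq (hF : Continuous F) (x : ℝ) :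
    ∃ y ∈ Icc x (x + 1), Phi F x = S F x - S F y ∧ ∀ z ∈ Icc x (x + 1), S F z ≤ S F y := by
  obtain ⟨y, hy, h⟩ := (isLeast_Phi hF x).1
  refine ⟨y, hy, h.symm, fun z hz => ?_⟩
  have := Phi_le hF hz
  simp only at h
  linarith

theorem Phi_eq_of_isMax (hF : Continuous F) {x y : ℝ} (hy : y ∈ Icc x (x + 1))
    (h : ∀ z ∈ Icc x (x + 1), S F z ≤ S F y) : Phi F x = S F x - S F y := by
  obtain ⟨z, hz, e, -⟩ := exists_Phi_eq hF x
  refine le_antisymm (Phi_le hF hy) ?_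
  linarith [h z hz]

theorem Phi_le_min (hF : Continuous F) (x : ℝ) : Phi F x ≤ min 0 (-S F 1) := by
  have h1 := Phi_le hF (x := x) (y := x) ⟨le_rfl, by linarith⟩
  have h2 := Phi_le hF (x := x) (y := x + 1) ⟨by linarith, le_rfl⟩
  rw [S_add_one hF] at h2
  exact le_min (by linarith) (by linarith)

theorem Phi_add_one (hF : Continuous F) (x : ℝ) : Phi F (x + 1) = Phi F x := by
  obtain ⟨y, hy, e, hmax⟩ := exists_Phi_eq hF x
  rw [e, Phi_eq_of_isMax hF (y := y + 1) ⟨by linarith [hy.1], by linarith [hy.2]⟩, S_add_one hF,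
    S_add_one hF]
  · ring
  · intro z hz
    have := hmax (z - 1) ⟨by linarith [hz.1], by linarith [hz.2]⟩
    have h2 := S_add_one hF (z - 1)
    rw [sub_add_cancel] at h2
    rw [S_add_one hF]
    linarith

theorem exists_lipschitzWith_Phi (hF : Continuous F) :
    ∃ L : NNReal, LipschitzWith L (Phi F) := by
  obtain ⟨C, hC⟩ := isCompact_univ.exists_bound_of_continuousOn hF.continuousOn
  have hC' : ∀ x, |F x| ≤ C := fun x => hC x (mem_univ x)
  have hC0 : 0 ≤ C := (abs_nonneg _).trans (hC' 0)
  have hS : ∀ u v : ℝ, |S F v - S F u| ≤ C * |v - u| := by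
    intro u v
    rw [S_sub hF, ← Real.norm_eq_abs]
    exact intervalIntegral.norm_integral_le_of_norm_le_const fun x _ => hC _ (mem_univ _)
  refine ⟨⟨2 * C, by positivity⟩, LipschitzWith.of_le_add_mul _ fun x y => ?_⟩
  obtain ⟨z, hz, e, -⟩ := exists_Phi_eq hF y
  -- The maximizing point is translated along with the window; each of the two values of `S` moves
  -- by at most `C * |x - y|`.
  have h1 := Phi_le hF (x := x) (y := x + (z - y)) ⟨by linarith [hz.1], by linarith [hz.2]⟩
  have h2 := (abs_le.1 (hS y x)).2
  have h3 := (abs_le.1 (hS z (x + (z - y)))).1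
  rw [show x + (z - y) - z = x - y by ring] at h3
  rw [Real.dist_eq]
  change _ ≤ _ + 2 * C * |x - y|
  linarith

theorem Phi_eq_of_monotone_or_antitone (hF : Continuous F)
    (h : Monotone (S F) ∨ Antitone (S F)) (x : ℝ) : Phi F x = min 0 (-S F 1) := by
  have h0 := S_zero F
  rcases h with h | h
  · have := h zero_le_one
    rw [min_eq_right (by linarith), Phi_eq_of_isMax hF (y := x + 1) ⟨by linarith, le_rfl⟩
      fun z hz => h hz.2, S_add_one hF]
    ring
  · have := h zero_le_one
    rw [min_eq_left (by linarith), Phi_eq_of_isMax hF (y := x) ⟨le_rfl, by linarith⟩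
      fun z hz => h hz.1, sub_self]

theorem periodic_S (hF : Continuous F) (h : S F 1 = 0) : Function.Periodic (S F) 1 := fun x => by
  rw [S_add_one hF, h, add_zero]

theorem Phi_eq_of_S_one_eq_zero (hF : Continuous F) (h : S F 1 = 0) (x : ℝ) :
    Phi F x = S F x + Phi F 0 := by
  have hp := periodic_S hF h
  obtain ⟨y, hy, e, hmax⟩ := exists_Phi_eq hF 0
  obtain ⟨y', hy', ey⟩ : S F y ∈ S F '' Icc x (x + 1) := by
    rw [hp.image_Icc one_pos x]
    exact mem_range_self y
  rw [Phi_eq_of_isMax hF hy', e, S_zero, ey]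
  · ring
  · intro z _
    obtain ⟨z', hz', ez⟩ : S F z ∈ S F '' Icc 0 (0 + 1) := by
      rw [hp.image_Icc one_pos 0]
      exact mem_range_self z
    rw [← ez, ey]
    exact hmax z' hz'

theorem continuous_Phi (hF : Continuous F) : Continuous (Phi F) :=
  (exists_lipschitzWith_Phi hF).choose_spec.continuous

theorem isOpen_U (hF : Continuous F) : IsOpen (U F) :=
  isOpen_ne.preimage (continuous_Phi hF)

theorem mem_U_iff (hF : Continuous F) {x : ℝ} :
    x ∈ U F ↔ ∃ y ∈ Icc x (x + 1), S F x < S F y ∧ S F (x + 1) < S F y := by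
  obtain ⟨y, hy, e, hmax⟩ := exists_Phi_eq hF x
  have hx1 := S_add_one hF x
  constructor
  · intro h
    have hlt := lt_of_le_of_ne (Phi_le_min hF x) h
    have h0 := hlt.trans_le (min_le_left _ _)
    have h1 := hlt.trans_le (min_le_right _ _)
    exact ⟨y, hy, by linarith, by linarith⟩
  · rintro ⟨z, hz, h0, h1⟩
    have hle := Phi_le hF hz
    exact (lt_min (by linarith) (by linarith)).ne

/-- The two windows share a maximizer. If S(1) < 0, take the maximizer `z` for `a`: were it left
behind (`z < x`), then `z ∈ U` would give a higher point in [z, z+1], and shifting that point back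
by a period if necessary only raises it, against maximality on [a, a+1]. If S(1) > 0, argue
symmetrically with the maximizer for `x`. -/
theorem Phi_sub_S_eq_of_Icc_subset_U (hF : Continuous F) (h1 : S F 1 ≠ 0) {a x : ℝ} (hax : a ≤ x)
    (hU : Icc a x ⊆ U F) : Phi F x - S F x = Phi F a - S F a := by
  rcases h1.lt_or_gt with h1 | h1
  · obtain ⟨z, hz, e, hmax⟩ := exists_Phi_eq hF a
    have hxz : x ≤ z := by
      by_contra! hzx
      obtain ⟨y, hy, hlt, -⟩ := (mem_U_iff hF).1 (hU ⟨hz.1, hzx.le⟩)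
      rcases le_total y (a + 1) with hya | hya
      · linarith [hmax y ⟨hz.1.trans hy.1, hya⟩]
      · have := hmax (y - 1) ⟨by linarith, by linarith [hy.2, hz.2]⟩
        have h2 := S_add_one hF (y - 1)
        rw [sub_add_cancel] at h2
        linarith
    rw [e, Phi_eq_of_isMax hF (y := z) ⟨hxz, by linarith [hz.2]⟩]
    · ring
    · intro y hy
      rcases le_total y (a + 1) with hya | hya
      · exact hmax y ⟨hax.trans hy.1, hya⟩
      · have := hmax (y - 1) ⟨by linarith, by linarith [hy.2, hz.2]⟩
        have h2 := S_add_one hF (y - 1)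
        rw [sub_add_cancel] at h2
        linarith
  · obtain ⟨z, hz, e, hmax⟩ := exists_Phi_eq hF x
    have hza : z ≤ a + 1 := by
      by_contra! hza
      obtain ⟨y, hy, -, hlt⟩ := (mem_U_iff hF).1 (hU (⟨by linarith, by linarith [hz.2]⟩ : z - 1 ∈ Icc a x))
      rw [sub_add_cancel] at hy hlt
      rcases le_total x y with hxy | hxy
      · linarith [hmax y ⟨hxy, hy.2.trans hz.2⟩]
      · have := hmax (y + 1) ⟨by linarith [hy.1, hz.1], by linarith⟩
        have h2 := S_add_one hF y
        linarith
    rw [e, Phi_eq_of_isMax hF (y := z) ⟨hax.trans hz.1, hza⟩]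
    · ring
    · intro y hy
      rcases le_total x y with hxy | hxy
      · exact hmax y ⟨hxy, hy.2.trans (by linarith)⟩
      · have := hmax (y + 1) ⟨by linarith [hy.1, hz.1], by linarith⟩
        have h2 := S_add_one hF y
        linarith

theorem Phi_eq_on_connectedComponentIn_U (hF : Continuous F) (h1 : S F 1 ≠ 0) (z : ℝ) :
    ∃ c : ℝ, ∀ x ∈ connectedComponentIn (U F) z, Phi F x = S F x + c := by
  by_cases hz : z ∈ U F
  · refine ⟨Phi F z - S F z, fun x hx => ?_⟩
    have hoc : OrdConnected (connectedComponentIn (U F) z) :=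
      isPreconnected_connectedComponentIn.ordConnected
    have hzz := mem_connectedComponentIn hz
    rcases le_total x z with hxz | hxz
    · have := Phi_sub_S_eq_of_Icc_subset_U hF h1 hxz
        ((hoc.out hx hzz).trans (connectedComponentIn_subset _ _))
      linarith
    · have := Phi_sub_S_eq_of_Icc_subset_U hF h1 hxz
        ((hoc.out hzz hx).trans (connectedComponentIn_subset _ _))
      linarith
  · exact ⟨0, by simp [connectedComponentIn_eq_empty hz]⟩

/-- The end `a` may lie outside `U`; the constant of Φ - S is carried to it by continuity. -/
theorem Phi_eq_of_Ioo_subset_U (hF : Continuous F) (h1 : S F 1 ≠ 0) {a b : ℝ}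
    (hU : Ioo a b ⊆ U F) {x : ℝ} (hx : x ∈ Ioo a b) :
    Phi F x = S F x - S F a + Phi F a := by
  have hlim : Tendsto (fun t => Phi F t - S F t) (𝓝[>] a) (𝓝 (Phi F a - S F a)) :=
    ((continuous_Phi hF).sub (continuous_S hF)).continuousAt.tendsto.mono_left nhdsWithin_le_nhds
  have hconst : ∀ᶠ t in 𝓝[>] a, Phi F x - S F x = Phi F t - S F t := by
    filter_upwards [Ioo_mem_nhdsGT hx.1] with t ht
    exact Phi_sub_S_eq_of_Icc_subset_U hF h1 ht.2.le fun s hs =>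
      hU ⟨ht.1.trans_le hs.1, hs.2.trans_lt hx.2⟩
  have := tendsto_nhds_unique (tendsto_const_nhds.congr' hconst) hlim
  linarith

/-- For S(1) < 0 the tilted function S(y) + εy still decreases over a period. At its maximum `x` the
slope of S is strictly negative, and S stays below S(x) on the window after `x`. Points just left of
`x` are therefore higher than everything in their own windows. -/
theorem nonempty_interior_compl_U (hF : Continuous F) (h1 : S F 1 ≠ 0) :
    (interior (U F)ᶜ).Nonempty := by
  rcases h1.lt_or_gt with h1 | h1
  · obtain ⟨ε, hε⟩ : ∃ ε, ε = -S F 1 / 2 := ⟨_, rfl⟩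
    have hcont : Continuous fun y => S F y + ε * y :=
      (continuous_S hF).add (continuous_const.mul continuous_id)
    obtain ⟨x, hx, hmax⟩ := isCompact_Icc.exists_isMaxOn (nonempty_Icc.2 (zero_le_one' ℝ))
      hcont.continuousOn
    -- Moving a point of [1, 2] back by a period raises the tilted function, so maximality on [0, 1]
    -- extends to [x, x+1].
    have hmax' : ∀ y ∈ Icc x (x + 1), S F y + ε * y ≤ S F x + ε * x := by
      intro y hy
      rcases le_total y 1 with hy1 | hy1
      · exact hmax ⟨hx.1.trans hy.1, hy1⟩
      · have h2 := hmax (⟨by linarith, by linarith [hy.2, hx.2]⟩ : y - 1 ∈ Icc (0 : ℝ) 1)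
        have h3 := S_add_one hF (y - 1)
        rw [sub_add_cancel] at h3
        change S F (y - 1) + ε * (y - 1) ≤ S F x + ε * x at h2
        linarith
    have hFx : F (x : UnitAddCircle) < 0 := by
      by_contra! hFx
      have hev : ∀ᶠ s : ℝ in 𝓝[>] x, -ε < F (s : UnitAddCircle) :=
        ((continuous_lift hF).continuousAt.eventually_const_lt
          (show -ε < F (x : UnitAddCircle) by linarith)).filter_mono nhdsWithin_le_nhds
      obtain ⟨u, hu, hIoo⟩ := (mem_nhdsGT_iff_exists_Ioo_subset).1 hev
      have hu' : x < min u (x + 1) := lt_min hu (by linarith)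
      obtain ⟨ξ, hξ, e⟩ := exists_S_sub_eq hF hu'
      have h4 : -ε < F (ξ : UnitAddCircle) := hIoo ⟨hξ.1, hξ.2.trans_le (min_le_left _ _)⟩
      have h5 := hmax' (min u (x + 1)) ⟨hu'.le, min_le_right _ _⟩
      nlinarith
    have hev : ∀ᶠ s : ℝ in 𝓝[<] x, F (s : UnitAddCircle) < 0 :=
      ((continuous_lift hF).continuousAt.eventually_lt_const hFx).filter_mono nhdsWithin_le_nhds
    obtain ⟨u, hu, hIoo⟩ := (mem_nhdsLT_iff_exists_Ioo_subset).1 hev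
    have hu : u < x := hu
    have hsub : Ioo u x ⊆ (U F)ᶜ := by
      intro w hw hwU
      obtain ⟨y, hy, hlt, -⟩ := (mem_U_iff hF).1 hwU
      have hwx : S F x < S F w := S_lt_of_neg hF hw.2 fun s hs => hIoo ⟨hw.1.trans hs.1, hs.2⟩
      rcases le_total y x with hyx | hyx
      · have := S_le_of_nonpos hF hy.1 fun s hs =>
          (show F (s : UnitAddCircle) < 0 from
            hIoo ⟨hw.1.trans hs.1, hs.2.trans_le hyx⟩).le
        linarith
      · have := hmax' y ⟨hyx, by linarith [hy.2, hw.2]⟩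
        nlinarith
    exact (nonempty_Ioo.2 hu).mono (interior_maximal hsub isOpen_Ioo)
  -- Mirror image: maximality holds on [x-1, x], and points just right of `x` have their window
  -- maximum at the right end `w + 1`.
  · obtain ⟨ε, hε⟩ : ∃ ε, ε = S F 1 / 2 := ⟨_, rfl⟩
    have hcont : Continuous fun y => S F y - ε * y :=
      (continuous_S hF).sub (continuous_const.mul continuous_id)
    obtain ⟨x, hx, hmax⟩ := isCompact_Icc.exists_isMaxOn (nonempty_Icc.2 (zero_le_one' ℝ))
      hcont.continuousOn
    have hmax' : ∀ y ∈ Icc (x - 1) x, S F y - ε * y ≤ S F x - ε * x := by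
      intro y hy
      rcases le_total 0 y with hy1 | hy1
      · exact hmax ⟨hy1, hy.2.trans hx.2⟩
      · have h2 := hmax (⟨by linarith [hy.1, hx.1], by linarith⟩ : y + 1 ∈ Icc (0 : ℝ) 1)
        have h3 := S_add_one hF y
        change S F (y + 1) - ε * (y + 1) ≤ S F x - ε * x at h2
        linarith
    have hFx : 0 < F (x : UnitAddCircle) := by
      by_contra! hFx
      have hev : ∀ᶠ s : ℝ in 𝓝[<] x, F (s : UnitAddCircle) < ε :=
        ((continuous_lift hF).continuousAt.eventually_lt_const
          (show F (x : UnitAddCircle) < ε by linarith)).filter_mono nhdsWithin_le_nhds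
      obtain ⟨u, hu, hIoo⟩ := (mem_nhdsLT_iff_exists_Ioo_subset).1 hev
      have hu' : max u (x - 1) < x := max_lt hu (by linarith)
      obtain ⟨ξ, hξ, e⟩ := exists_S_sub_eq hF hu'
      have h4 : F (ξ : UnitAddCircle) < ε := hIoo ⟨(le_max_left _ _).trans_lt hξ.1, hξ.2⟩
      have h5 := hmax' (max u (x - 1)) ⟨le_max_right _ _, hu'.le⟩
      nlinarith
    have hev : ∀ᶠ s : ℝ in 𝓝[>] x, 0 < F (s : UnitAddCircle) :=
      ((continuous_lift hF).continuousAt.eventually_const_lt hFx).filter_mono nhdsWithin_le_nhds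
    obtain ⟨u, hu, hIoo⟩ := (mem_nhdsGT_iff_exists_Ioo_subset).1 hev
    have hu : x < u := hu
    have hsub : Ioo x u ⊆ (U F)ᶜ := by
      intro w hw hwU
      obtain ⟨y, hy, -, hlt⟩ := (mem_U_iff hF).1 hwU
      have hwx : S F x < S F w := S_lt_of_pos hF hw.1 fun s hs => hIoo ⟨hs.1, hs.2.trans hw.2⟩
      have e1 := S_add_one hF (y - 1)
      have e2 := S_add_one hF w
      rw [sub_add_cancel] at e1
      rcases le_total x (y - 1) with hyx | hyx
      · have := S_le_of_nonneg hF (u := y - 1) (v := w) (by linarith [hy.2]) fun s hs =>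
          (show 0 < F (s : UnitAddCircle) from
            hIoo ⟨hyx.trans_lt hs.1, hs.2.trans hw.2⟩).le
        linarith
      · have := hmax' (y - 1) ⟨by linarith [hy.1, hw.1], hyx⟩
        nlinarith
    exact (nonempty_Ioo.2 hu).mono (interior_maximal hsub isOpen_Ioo)

theorem exists_mem_Ico_Phi_eq (hF : Continuous F) (x a : ℝ) :
    ∃ y ∈ Ico a (a + 1), Phi F y = Phi F x := by
  have hp : Function.Periodic (Phi F) 1 := Phi_add_one hF
  obtain ⟨y, hy, e⟩ := hp.exists_mem_Ico one_pos x a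
  exact ⟨y, hy, e.symm⟩

/-! ### Positive and negative parts, and the cost `V` on lifts. -/

theorem continuous_posPart (hF : Continuous F) : Continuous (posPart F) :=
  hF.max continuous_const

theorem continuous_negPart (hF : Continuous F) : Continuous (negPart F) :=
  (hF.min continuous_const).abs

theorem posPart_nonneg (F : UnitAddCircle → ℝ) (x : UnitAddCircle) : 0 ≤ posPart F x :=
  le_max_right _ _

theorem negPart_nonneg (F : UnitAddCircle → ℝ) (x : UnitAddCircle) : 0 ≤ negPart F x :=
  abs_nonneg _

theorem posPart_eq_zero {x : UnitAddCircle} (h : F x ≤ 0) : posPart F x = 0 :=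
  max_eq_right h

theorem negPart_eq_zero {x : UnitAddCircle} (h : 0 ≤ F x) : negPart F x = 0 := by
  rw [negPart, min_eq_right h, abs_zero]

theorem posPart_sub_negPart (F : UnitAddCircle → ℝ) (x : UnitAddCircle) :
    posPart F x - negPart F x = F x := by
  rcases le_total (F x) 0 with h | h
  · rw [posPart_eq_zero h, negPart, min_eq_left h, abs_of_nonpos h]
    ring
  · rw [negPart_eq_zero h, posPart, max_eq_left h, sub_zero]

/-- The primitive of the positive part. -/
noncomputable def primPos (F : UnitAddCircle → ℝ) : ℝ → ℝ := S (posPart F)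

/-- The primitive of the negative part. -/
noncomputable def primNeg (F : UnitAddCircle → ℝ) : ℝ → ℝ := S (negPart F)

theorem monotone_primPos (hF : Continuous F) : Monotone (primPos F) := fun _ _ h =>
  S_le_of_nonneg (continuous_posPart hF) h fun _ _ => posPart_nonneg F _

theorem monotone_primNeg (hF : Continuous F) : Monotone (primNeg F) := fun _ _ h =>
  S_le_of_nonneg (continuous_negPart hF) h fun _ _ => negPart_nonneg F _

theorem primPos_sub_primNeg (hF : Continuous F) (x : ℝ) : primPos F x - primNeg F x = S F x := by
  rw [primPos, primNeg, S, S, ← intervalIntegral.integral_sub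
    ((continuous_lift (continuous_posPart hF)).intervalIntegrable _ _)
    ((continuous_lift (continuous_negPart hF)).intervalIntegrable _ _)]
  simp only [posPart_sub_negPart, S]

theorem primPos_eq_of_nonpos (hF : Continuous F) {u v : ℝ} (huv : u ≤ v)
    (h : ∀ s ∈ Ioo u v, F (s : UnitAddCircle) ≤ 0) : primPos F u = primPos F v :=
  S_eq_of_eq_zero (continuous_posPart hF) huv fun s hs => posPart_eq_zero (h s hs)

theorem primNeg_eq_of_nonneg (hF : Continuous F) {u v : ℝ} (huv : u ≤ v)
    (h : ∀ s ∈ Ioo u v, 0 ≤ F (s : UnitAddCircle)) : primNeg F u = primNeg F v :=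
  S_eq_of_eq_zero (continuous_negPart hF) huv fun s hs => negPart_eq_zero (h s hs)

/-- The cost of going from `u` to `v` on the line. -/
noncomputable def VReal (F : UnitAddCircle → ℝ) (u v : ℝ) : ℝ :=
  max (primPos F v - primPos F u) 0 + max (primNeg F u - primNeg F v) 0

theorem VReal_nonneg (F : UnitAddCircle → ℝ) (u v : ℝ) : 0 ≤ VReal F u v :=
  add_nonneg (le_max_right _ _) (le_max_right _ _)

theorem VReal_self (F : UnitAddCircle → ℝ) (u : ℝ) : VReal F u u = 0 := by
  simp [VReal]

theorem VReal_of_le (hF : Continuous F) {u v : ℝ} (h : u ≤ v) :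
    VReal F u v = primPos F v - primPos F u := by
  rw [VReal, max_eq_left (sub_nonneg.2 (monotone_primPos hF h)),
    max_eq_right (sub_nonpos.2 (monotone_primNeg hF h)), add_zero]

theorem VReal_of_ge (hF : Continuous F) {u v : ℝ} (h : v ≤ u) :
    VReal F u v = primNeg F u - primNeg F v := by
  rw [VReal, max_eq_left (sub_nonneg.2 (monotone_primNeg hF h)),
    max_eq_right (sub_nonpos.2 (monotone_primPos hF h)), zero_add]

/-- With the formula written through `max`, no case distinction on the order of the points is
needed: the positive part is subadditive. -/
theorem VReal_triangle (F : UnitAddCircle → ℝ) (u v w : ℝ) :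
    VReal F u w ≤ VReal F u v + VReal F v w := by
  have key : ∀ a b c : ℝ, a = b + c → max a 0 ≤ max b 0 + max c 0 := by
    rintro _ b c rfl
    exact max_le (add_le_add (le_max_left _ _) (le_max_left _ _))
      (add_nonneg (le_max_right _ _) (le_max_right _ _))
  have h1 := key (primPos F w - primPos F u) (primPos F v - primPos F u)
    (primPos F w - primPos F v) (by ring)
  have h2 := key (primNeg F u - primNeg F w) (primNeg F u - primNeg F v)
    (primNeg F v - primNeg F w) (by ring)
  unfold VReal
  linarith

theorem VReal_add_int (hF : Continuous F) (u v : ℝ) (k : ℤ) :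
    VReal F (u + k) (v + k) = VReal F u v := by
  simp only [VReal, primPos, primNeg, S_add_int (continuous_posPart hF),
    S_add_int (continuous_negPart hF)]
  congr 2 <;> ring

theorem rep_coe (u : ℝ) : rep (u : UnitAddCircle) = u - ⌊u⌋ := by
  have h := AddCircle.coe_equivIco_mk_apply (p := (1 : ℝ)) u
  rw [div_one, mul_one] at h
  exact h

theorem integralCW_coe {h : UnitAddCircle → ℝ} (hh : Continuous h) {u v : ℝ} (huv : u ≤ v)
    (hvu : v < u + 1) :
    integralCW h (u : UnitAddCircle) (v : UnitAddCircle) = S h v - S h u := by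
  rw [integralCW, rep_coe, rep_coe, ← S_sub hh, ← S_sub hh]
  have e : ∀ (x : ℝ) (k : ℤ), S h (x - k) = S h x - k * S h 1 := fun x k => by
    have := S_add_int hh x (-k)
    push_cast at this
    rw [sub_eq_add_neg, this]
    ring
  have h1 : ⌊u⌋ ≤ ⌊v⌋ := Int.floor_le_floor huv
  have h2 : ⌊v⌋ ≤ ⌊u⌋ + 1 := by
    rw [← Int.floor_add_one]
    exact Int.floor_le_floor hvu.le
  rcases h1.eq_or_lt with h1 | h1
  · rw [← h1]
    rcases huv.eq_or_lt with rfl | huv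
    · simp
    · rw [if_pos (by linarith), e, e]
      ring
  · have h3 : ⌊v⌋ = ⌊u⌋ + 1 := by omega
    have h4 : v - ((⌊u⌋ + 1 : ℤ) : ℝ) + 1 = v - (⌊u⌋ : ℤ) := by push_cast; ring
    have h5 : v - ((⌊u⌋ + 1 : ℤ) : ℝ) < u - (⌊u⌋ : ℤ) := by push_cast; linarith
    rw [h3, if_neg h5.not_gt, if_pos h5, h4, e, e]
    ring

theorem integralCCW_eq (h : UnitAddCircle → ℝ) (x y : UnitAddCircle) :
    integralCCW h x y = integralCW h y x := rfl

/-- The two arcs from `u` to `v` correspond to the lifts `v` and `v - 1` of the target. -/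
theorem V_coe (hF : Continuous F) {u v : ℝ} (huv : u ≤ v) (hvu : v < u + 1) :
    V F (u : UnitAddCircle) (v : UnitAddCircle) = min (VReal F u v) (VReal F u (v - 1)) := by
  rw [V, VPlus, VMinus, integralCCW_eq, integralCW_coe (continuous_posPart hF) huv hvu,
    VReal_of_le hF huv]
  -- For `u = v` both arc integrals are `0` by convention, which matches the lift `u` itself but not
  -- the full turn to `u - 1`.
  rcases huv.eq_or_lt with rfl | huv
  · rw [integralCW_coe (continuous_negPart hF) le_rfl hvu]
    simp [VReal_nonneg]
  · rw [← coe_add_one u, integralCW_coe (continuous_negPart hF) hvu.le (by linarith),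
      ← VReal_add_int hF u (v - 1) 1]
    push_cast
    rw [sub_add_cancel, VReal_of_ge hF hvu.le]
    rfl

/-- Among lifts on the same side of `u`, a farther one costs at least as much, by monotonicity of
the primitives. -/
theorem V_coe_le_VReal (hF : Continuous F) (u v : ℝ) :
    V F (u : UnitAddCircle) (v : UnitAddCircle) ≤ VReal F u v := by
  have hw : ((v + (-⌊v - u⌋ : ℤ) : ℝ) : UnitAddCircle) = v := coe_add_int v _
  have h1 := Int.floor_le (v - u)
  have h2 := Int.lt_floor_add_one (v - u)
  rw [← hw, V_coe hF (by push_cast; linarith) (by push_cast; linarith)]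
  rcases le_or_gt u v with huv | huv
  · refine (min_le_left _ _).trans ?_
    have h3 : (0 : ℝ) ≤ ⌊v - u⌋ := by exact_mod_cast Int.floor_nonneg.2 (sub_nonneg.2 huv)
    rw [VReal_of_le hF (by push_cast; linarith), VReal_of_le hF huv]
    have := monotone_primPos hF (show v + (-⌊v - u⌋ : ℤ) ≤ v by push_cast; linarith)
    linarith
  · refine (min_le_right _ _).trans ?_
    have h4 : ⌊v - u⌋ < 0 := Int.floor_lt.2 (by push_cast; linarith)
    have h3 : (⌊v - u⌋ : ℝ) ≤ -1 := by exact_mod_cast (by omega : ⌊v - u⌋ ≤ -1)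
    rw [VReal_of_ge hF (by push_cast; linarith), VReal_of_ge hF huv.le]
    have := monotone_primNeg hF (show v ≤ v + (-⌊v - u⌋ : ℤ) - 1 by push_cast; linarith)
    linarith

theorem exists_V_coe_eq (hF : Continuous F) (u v : ℝ) :
    ∃ w ∈ Ioo (u - 1) (u + 1), (w : UnitAddCircle) = v ∧
      V F (u : UnitAddCircle) (v : UnitAddCircle) = VReal F u w := by
  obtain ⟨w, hw, e⟩ : ∃ w ∈ Ico u (u + 1), (w : UnitAddCircle) = v := by
    refine ⟨v + (-⌊v - u⌋ : ℤ), ⟨?_, ?_⟩, coe_add_int v _⟩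
    · have h1 := Int.floor_le (v - u)
      push_cast
      linarith
    · have h2 := Int.lt_floor_add_one (v - u)
      push_cast
      linarith
  rw [← e, V_coe hF hw.1 hw.2]
  rcases hw.1.eq_or_lt with rfl | hlt
  · refine ⟨u, ⟨by linarith, hw.2⟩, rfl, ?_⟩
    rw [VReal_self]
    exact min_eq_left (VReal_nonneg F _ _)
  · rcases min_choice (VReal F u w) (VReal F u (w - 1)) with h | h
    · exact ⟨w, ⟨by linarith, hw.2⟩, rfl, h⟩
    · refine ⟨w - 1, ⟨by linarith, by linarith [hw.2]⟩, ?_, h⟩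
      rw [← coe_add_one, sub_add_cancel]

theorem V_nonneg (hF : Continuous F) (x y : UnitAddCircle) : 0 ≤ V F x y := by
  induction x using QuotientAddGroup.induction_on with | H u =>
  induction y using QuotientAddGroup.induction_on with | H v =>
  obtain ⟨w, -, -, h⟩ := exists_V_coe_eq hF u v
  exact (VReal_nonneg F u w).trans_eq h.symm

theorem V_triangle (hF : Continuous F) (x y z : UnitAddCircle) :
    V F x z ≤ V F x y + V F y z := by
  induction x using QuotientAddGroup.induction_on with | H u =>
  induction y using QuotientAddGroup.induction_on with | H v =>
  induction z using QuotientAddGroup.induction_on with | H w =>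
  obtain ⟨v', -, ev, h1⟩ := exists_V_coe_eq hF u v
  obtain ⟨w', -, ew, h2⟩ := exists_V_coe_eq hF v' w
  rw [ev] at h2
  have h3 := V_coe_le_VReal hF u w'
  rw [ew] at h3
  have := VReal_triangle F u v' w'
  change V F (u : UnitAddCircle) (w : UnitAddCircle) ≤
    V F (u : UnitAddCircle) (v : UnitAddCircle) + V F (v : UnitAddCircle) (w : UnitAddCircle)
  linarith

theorem V_coe_eq_zero (hF : Continuous F) {a b : ℝ}
    (h : ∀ s ∈ Icc a b, F (s : UnitAddCircle) = 0) {u v : ℝ} (hu : u ∈ Icc a b)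
    (hv : v ∈ Icc a b) : V F (u : UnitAddCircle) (v : UnitAddCircle) = 0 := by
  refine le_antisymm ((V_coe_le_VReal hF u v).trans_eq ?_) (V_nonneg hF _ _)
  rcases le_total u v with huv | huv
  · rw [VReal_of_le hF huv, primPos_eq_of_nonpos hF huv, sub_self]
    exact fun s hs => (h s ⟨hu.1.trans hs.1.le, hs.2.le.trans hv.2⟩).le
  · rw [VReal_of_ge hF huv, primNeg_eq_of_nonneg hF huv, sub_self]
    exact fun s hs => (h s ⟨hv.1.trans hs.1.le, hs.2.le.trans hu.2⟩).ge

theorem Phi_eq_of_coe_eq (hF : Continuous F) {x y : ℝ}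
    (h : (x : UnitAddCircle) = (y : UnitAddCircle)) : Phi F x = Phi F y := by
  obtain ⟨k, rfl⟩ := exists_int_of_coe_eq h
  have hp : Function.Periodic (Phi F) 1 := Phi_add_one hF
  have := hp.int_mul k y
  rwa [mul_one] at this

/-- Follow the cheapest lifted path from `y` to `w` and keep the maximizer `z` of the window at `y`
as competitor at `w`. If `z` has dropped out of the new window, the bound Φ(w) ≤ min{0, -S(1)}
suffices, since the path has then passed `z` or `z - 1`. -/
theorem Phi_le_Phi_add_V (hF : Continuous F) (x y : ℝ) :
    Phi F x ≤ Phi F y + V F (y : UnitAddCircle) (x : UnitAddCircle) := by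
  obtain ⟨w, hw, ew, h⟩ := exists_V_coe_eq hF y x
  rw [h, ← Phi_eq_of_coe_eq hF ew]
  obtain ⟨z, hz, e, -⟩ := exists_Phi_eq hF y
  rw [e]
  have hS := primPos_sub_primNeg hF
  have hw0 := Phi_le_min hF w
  have hw1 := hw0.trans (min_le_right _ _)
  have hw2 := hw0.trans (min_le_left _ _)
  rcases le_total y w with hyw | hyw
  · rw [VReal_of_le hF hyw]
    rcases le_total w z with hwz | hwz
    · have := Phi_le hF (x := w) (y := z) ⟨hwz, by linarith [hz.2]⟩
      have := monotone_primNeg hF hyw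
      linarith [hS w, hS y]
    · have := monotone_primPos hF hwz
      have := monotone_primNeg hF hz.1
      linarith [hS z, hS y]
  · rw [VReal_of_ge hF hyw]
    rcases le_total z (w + 1) with hwz | hwz
    · have := Phi_le hF (x := w) (y := z) ⟨hyw.trans hz.1, hwz⟩
      have := monotone_primPos hF hyw
      linarith [hS w, hS y]
    · have h1 := monotone_primPos hF (show z - 1 ≤ y by linarith [hz.2])
      have h2 := monotone_primNeg hF (show w ≤ z - 1 by linarith)
      have h3 := S_add_one hF (z - 1)
      rw [sub_add_cancel] at h3
      linarith [hS (z - 1), hS y]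

/-! ### Local structure of the zero set and existence of stable intervals. -/

theorem coe_injOn_Ico {a x y : ℝ} (hx : x ∈ Ico a (a + 1)) (hy : y ∈ Ico a (a + 1))
    (h : (x : UnitAddCircle) = (y : UnitAddCircle)) : x = y :=
  (AddCircle.coe_eq_coe_iff_of_mem_Ico (p := (1 : ℝ)) hx hy).1 h

/-- A preconnected set of zeros of `F` lies inside an arc whose ends are not zeros, or avoids it. -/
theorem subset_arc_or_disjoint {w' w : ℝ} (hw' : F (w' : UnitAddCircle) ≠ 0)
    (hw : F (w : UnitAddCircle) ≠ 0) {C : Set UnitAddCircle} (hC : IsPreconnected C)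
    (hCZ : C ⊆ {z | F z = 0}) :
    C ⊆ (fun s : ℝ => (s : UnitAddCircle)) '' Ioo w' w ∨
      Disjoint C ((fun s : ℝ => (s : UnitAddCircle)) '' Icc w' w) := by
  have ho : IsOpen ((fun s : ℝ => (s : UnitAddCircle)) '' Ioo w' w) :=
    QuotientAddGroup.isOpenMap_coe _ isOpen_Ioo
  have hc : IsClosed ((fun s : ℝ => (s : UnitAddCircle)) '' Icc w' w) :=
    (isCompact_Icc.image (AddCircle.continuous_mk' 1)).isClosed
  rw [← subset_compl_iff_disjoint_right]
  refine isPreconnected_iff_subset_of_disjoint.1 hC _ _ ho hc.isOpen_compl ?_ ?_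
  · intro c hcC
    by_cases h : c ∈ (fun s : ℝ => (s : UnitAddCircle)) '' Icc w' w
    · obtain ⟨s, hs, rfl⟩ := h
      have h0 : F (s : UnitAddCircle) = 0 := hCZ hcC
      refine Or.inl ⟨s, ⟨lt_of_le_of_ne hs.1 ?_, lt_of_le_of_ne hs.2 ?_⟩, rfl⟩
      · rintro rfl
        exact hw' h0
      · rintro rfl
        exact hw h0
    · exact Or.inr h
  · refine eq_empty_of_forall_notMem ?_
    rintro c ⟨-, h1, h2⟩
    exact h2 (image_mono Ioo_subset_Icc_self h1)

theorem mem_zeroComponents_self {x : UnitAddCircle} (hx : F x = 0) :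
    connectedComponentIn {z | F z = 0} x ∈ zeroComponents F ∧
      x ∈ connectedComponentIn {z | F z = 0} x :=
  ⟨⟨x, hx, rfl⟩, mem_connectedComponentIn hx⟩

theorem isPreconnected_of_mem_zeroComponents {C : Set UnitAddCircle} (h : C ∈ zeroComponents F) :
    IsPreconnected C ∧ C ⊆ {z | F z = 0} := by
  obtain ⟨x, -, rfl⟩ := h
  exact ⟨isPreconnected_connectedComponentIn, connectedComponentIn_subset _ _⟩

/-- Otherwise zeros and non-zeros both accumulate at `x` from the right. A component with a point
near `x` is then caught in an arc between two non-zeros, so it stays away from `x`. Finitely many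
components leave no zeros immediately to the right of `x`, a contradiction. -/
theorem exists_Ioo_right (hfin : (zeroComponents F).Finite) (x : ℝ) :
    ∃ ε > 0, (∀ s ∈ Ioo x (x + ε), F (s : UnitAddCircle) = 0) ∨
      (∀ s ∈ Ioo x (x + ε), F (s : UnitAddCircle) ≠ 0) := by
  by_contra! hcon
  have hC : ∀ C ∈ zeroComponents F, ∀ᶠ s : ℝ in 𝓝[>] x, (s : UnitAddCircle) ∉ C := by
    intro C hC
    obtain ⟨hpre, hZ⟩ := isPreconnected_of_mem_zeroComponents hC
    -- The bound `1 / 2` keeps the arc within one period, where the projection is injective.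
    obtain ⟨⟨w, hw, hFw⟩, -⟩ := hcon (1 / 2) (by norm_num)
    by_cases hz : ∃ z ∈ Ioo x w, (z : UnitAddCircle) ∈ C
    · obtain ⟨z, hz, hzC⟩ := hz
      obtain ⟨⟨w', hw', hFw'⟩, -⟩ := hcon (z - x) (by linarith [hz.1])
      rcases subset_arc_or_disjoint hFw' hFw hpre hZ with h | h
      · filter_upwards [Ioo_mem_nhdsGT hw'.1] with s hs hsC
        obtain ⟨r, hr, e⟩ := h hsC
        have := coe_injOn_Ico (a := x) ⟨by linarith [hr.1, hs.1, hs.2], by linarith [hr.2, hw.2]⟩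
          ⟨hs.1.le, by linarith [hs.2, hw'.2, hz.2, hw.2]⟩ e
        linarith [hr.1, hs.2]
      · exact absurd ⟨z, ⟨by linarith [hw'.2], hz.2.le⟩, rfl⟩ (disjoint_left.1 h hzC)
    · filter_upwards [Ioo_mem_nhdsGT hw.1] with s hs hsC
      exact hz ⟨s, hs, hsC⟩
  obtain ⟨u, hu, hIoo⟩ :=
    mem_nhdsGT_iff_exists_Ioo_subset.1 ((eventually_all_finite hfin).2 hC)
  obtain ⟨-, z, hz, hFz⟩ := hcon (u - x) (sub_pos.2 hu)
  obtain ⟨h1, h2⟩ := mem_zeroComponents_self hFz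
  exact hIoo ⟨hz.1, by linarith [hz.2]⟩ _ h1 h2

theorem exists_Ioo_left (hfin : (zeroComponents F).Finite) (x : ℝ) :
    ∃ ε > 0, (∀ s ∈ Ioo (x - ε) x, F (s : UnitAddCircle) = 0) ∨
      (∀ s ∈ Ioo (x - ε) x, F (s : UnitAddCircle) ≠ 0) := by
  by_contra! hcon
  have hC : ∀ C ∈ zeroComponents F, ∀ᶠ s : ℝ in 𝓝[<] x, (s : UnitAddCircle) ∉ C := by
    intro C hC
    obtain ⟨hpre, hZ⟩ := isPreconnected_of_mem_zeroComponents hC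
    obtain ⟨⟨w, hw, hFw⟩, -⟩ := hcon (1 / 2) (by norm_num)
    by_cases hz : ∃ z ∈ Ioo w x, (z : UnitAddCircle) ∈ C
    · obtain ⟨z, hz, hzC⟩ := hz
      obtain ⟨⟨w', hw', hFw'⟩, -⟩ := hcon (x - z) (by linarith [hz.2])
      rcases subset_arc_or_disjoint hFw hFw' hpre hZ with h | h
      · filter_upwards [Ioo_mem_nhdsLT hw'.2] with s hs hsC
        obtain ⟨r, hr, e⟩ := h hsC
        have := coe_injOn_Ico (a := x - 1 / 2) ⟨by linarith [hr.1, hw.1], by linarith [hr.2, hw'.2]⟩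
          ⟨by linarith [hs.1, hw'.1, hz.1, hw.1], by linarith [hs.2]⟩ e
        linarith [hr.2, hs.1]
      · exact absurd ⟨z, ⟨hz.1.le, by linarith [hw'.1]⟩, rfl⟩ (disjoint_left.1 h hzC)
    · filter_upwards [Ioo_mem_nhdsLT hw.2] with s hs hsC
      exact hz ⟨s, hs, hsC⟩
  obtain ⟨u, hu, hIoo⟩ :=
    mem_nhdsLT_iff_exists_Ioo_subset.1 ((eventually_all_finite hfin).2 hC)
  have hu : u < x := hu
  obtain ⟨-, z, hz, hFz⟩ := hcon (x - u) (sub_pos.2 hu)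
  obtain ⟨h1, h2⟩ := mem_zeroComponents_self hFz
  exact hIoo ⟨by linarith [hz.1], hz.2⟩ _ h1 h2

theorem pos_or_neg_of_ne_zero {f : ℝ → ℝ} (hf : Continuous f) {u v : ℝ}
    (h : ∀ s ∈ Ioo u v, f s ≠ 0) : (∀ s ∈ Ioo u v, 0 < f s) ∨ (∀ s ∈ Ioo u v, f s < 0) := by
  by_contra! hcon
  obtain ⟨⟨s, hs, hfs⟩, t, ht, hft⟩ := hcon
  obtain ⟨r, hr, e⟩ := isPreconnected_Ioo.intermediate_value hs ht hf.continuousOn ⟨hfs, hft⟩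
  exact h r hr e

theorem exists_right_end {f : ℝ → ℝ} (hf : Continuous f)
    (hloc : ∀ x, ∃ ε > 0, (∀ s ∈ Ioo x (x + ε), f s = 0) ∨ (∀ s ∈ Ioo x (x + ε), f s ≠ 0))
    {m y : ℝ} (hmy : m < y) (hm : f m = 0) (hy : f y ≠ 0) :
    ∃ b ∈ Ico m y, (∀ s ∈ Icc m b, f s = 0) ∧
      ∃ ε > 0, b + ε < y ∧ ((∀ s ∈ Ioc b (b + ε), 0 < f s) ∨ (∀ s ∈ Ioc b (b + ε), f s < 0)) := by
  set B : Set ℝ := {z ∈ Icc m y | f z ≠ 0} with hB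
  have hyB : y ∈ B := ⟨⟨hmy.le, le_rfl⟩, hy⟩
  have hbdd : BddBelow B := ⟨m, fun z hz => hz.1.1⟩
  have hmb : m ≤ sInf B := le_csInf ⟨y, hyB⟩ fun z hz => hz.1.1
  have hby : sInf B ≤ y := csInf_le hbdd hyB
  have h0 : ∀ s ∈ Ico m (sInf B), f s = 0 := fun s hs => by
    by_contra hs0
    exact absurd (csInf_le hbdd ⟨⟨hs.1, hs.2.le.trans hby⟩, hs0⟩) hs.2.not_ge
  have hb0 : f (sInf B) = 0 := by
    rcases hmb.eq_or_lt with h | h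
    · rw [← h, hm]
    · have hcl : IsClosed {s | f s = 0} := isClosed_eq hf continuous_const
      have : Icc m (sInf B) ⊆ {s | f s = 0} := by
        rw [← closure_Ico h.ne]
        exact hcl.closure_subset_iff.2 h0
      exact this ⟨hmb, le_rfl⟩
  have hby' : sInf B < y := lt_of_le_of_ne hby fun h => hy (h ▸ hb0)
  refine ⟨sInf B, ⟨hmb, hby'⟩, fun s hs => ?_, ?_⟩
  · rcases hs.2.eq_or_lt with h | h
    · rw [h, hb0]
    · exact h0 s ⟨hs.1, h⟩
  · obtain ⟨ε, hε, h⟩ := hloc (sInf B)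
    have hne : ∀ s ∈ Ioo (sInf B) (sInf B + ε), f s ≠ 0 := by
      refine h.resolve_left fun h => ?_
      obtain ⟨z, hz, hlt⟩ := exists_lt_of_csInf_lt ⟨y, hyB⟩ (lt_add_of_pos_right (sInf B) hε)
      rcases (csInf_le hbdd hz).eq_or_lt with e | e
      · exact hz.2 (e ▸ hb0)
      · exact hz.2 (h z ⟨e, hlt⟩)
    have h1 := min_le_left ε (y - sInf B)
    have h2 := min_le_right ε (y - sInf B)
    have h3 : 0 < min ε (y - sInf B) := lt_min hε (by linarith)
    refine ⟨min ε (y - sInf B) / 2, by linarith, by linarith, ?_⟩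
    exact (pos_or_neg_of_ne_zero hf hne).imp (fun h s hs => h s ⟨hs.1, by linarith [hs.2]⟩)
      fun h s hs => h s ⟨hs.1, by linarith [hs.2]⟩

theorem exists_left_end {f : ℝ → ℝ} (hf : Continuous f)
    (hloc : ∀ x, ∃ ε > 0, (∀ s ∈ Ioo (x - ε) x, f s = 0) ∨ (∀ s ∈ Ioo (x - ε) x, f s ≠ 0))
    {x m : ℝ} (hxm : x < m) (hm : f m = 0) (hx : f x ≠ 0) :
    ∃ a ∈ Ioc x m, (∀ s ∈ Icc a m, f s = 0) ∧
      ∃ ε > 0, x < a - ε ∧ ((∀ s ∈ Ico (a - ε) a, 0 < f s) ∨ (∀ s ∈ Ico (a - ε) a, f s < 0)) := by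
  obtain ⟨b, hb, h0, ε, hε, hε', h⟩ := exists_right_end (f := fun s => f (-s))
    (hf.comp continuous_neg) (m := -m) (y := -x) (fun x => by
      obtain ⟨ε, hε, h⟩ := hloc (-x)
      refine ⟨ε, hε, h.imp (fun h s hs => h (-s) ?_) fun h s hs => h (-s) ?_⟩ <;>
      exact ⟨by linarith [hs.2], by linarith [hs.1]⟩)
    (by linarith) (by simpa using hm) (by simpa using hx)
  refine ⟨-b, ⟨by linarith [hb.2], by linarith [hb.1]⟩, fun s hs => ?_, ε, hε, by linarith, ?_⟩
  · simpa using h0 (-s) ⟨by linarith [hs.2], by linarith [hs.1]⟩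
  · refine h.imp (fun h s hs => ?_) fun h s hs => ?_ <;>
    simpa using h (-s) ⟨by linarith [hs.2], by linarith [hs.1]⟩

/-- `[a, b]` is a lift of a stable component of `{F = 0}`. -/
structure IsStableInterval (F : UnitAddCircle → ℝ) (a b : ℝ) : Prop where
  le : a ≤ b
  zero : ∀ s ∈ Icc a b, F (s : UnitAddCircle) = 0
  sign : ∃ ε : ℝ, 0 < ε ∧ (∀ s ∈ Ico (a - ε) a, F (s : UnitAddCircle) < 0) ∧
    ∀ s ∈ Ioc b (b + ε), 0 < F (s : UnitAddCircle)

/-- The component cannot extend beyond the interval: it is trapped between the non-zeros `a - ε` and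
`b + ε`, and the strict signs leave only [a, b]. -/
theorem IsStableInterval.mem_stableComponents {a b : ℝ} (h : IsStableInterval F a b) :
    (fun s : ℝ => (s : UnitAddCircle)) '' Icc a b ∈ stableComponents F := by
  obtain ⟨ε, hε, hneg, hpos⟩ := h.sign
  refine ⟨⟨a, h.zero a ⟨le_rfl, h.le⟩, ?_⟩, a, b, h.le, rfl, ε, hε, hneg, hpos⟩
  have ha : (a : UnitAddCircle) ∈ (fun s : ℝ => (s : UnitAddCircle)) '' Icc a b :=
    ⟨a, ⟨le_rfl, h.le⟩, rfl⟩
  have hZ : (fun s : ℝ => (s : UnitAddCircle)) '' Icc a b ⊆ {z | F z = 0} := by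
    rintro _ ⟨s, hs, rfl⟩
    exact h.zero s hs
  refine Subset.antisymm ((isPreconnected_Icc.image _
    (AddCircle.continuous_mk' 1).continuousOn).subset_connectedComponentIn ha hZ) ?_
  have hle := h.le
  rcases subset_arc_or_disjoint (w' := a - ε) (w := b + ε)
      (hneg _ ⟨le_rfl, by linarith⟩).ne (hpos _ ⟨by linarith, le_rfl⟩).ne'
      (isPreconnected_connectedComponentIn (F := {z | F z = 0}) (x := (a : UnitAddCircle)))
      (connectedComponentIn_subset _ _) with h1 | h1
  · intro c hc
    obtain ⟨s, hs, rfl⟩ := h1 hc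
    have hs0 : (s : UnitAddCircle) ∈ {z | F z = 0} := connectedComponentIn_subset _ _ hc
    refine ⟨s, ⟨?_, ?_⟩, rfl⟩
    · by_contra! hlt
      exact (hneg s ⟨hs.1.le, hlt⟩).ne hs0
    · by_contra! hlt
      exact (hpos s ⟨hlt, hs.2.le⟩).ne' hs0
  · exact absurd ⟨a, ⟨by linarith, by linarith⟩, rfl⟩
      (disjoint_left.1 h1 (mem_connectedComponentIn (hZ ha)))

theorem exists_isStableInterval {C : Set UnitAddCircle} (hC : C ∈ stableComponents F) :
    ∃ a b : ℝ, C = (fun s : ℝ => (s : UnitAddCircle)) '' Icc a b ∧ IsStableInterval F a b := by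
  obtain ⟨hC, a, b, hab, rfl, hε⟩ := hC
  refine ⟨a, b, rfl, hab, fun s hs => ?_, hε⟩
  exact (isPreconnected_of_mem_zeroComponents hC).2 ⟨s, hs, rfl⟩

/-- The signs at the ends force the minimum of S over [x, y] into the interior, hence onto a zero of
F. The maximal interval of zeros around it is stable, since the wrong sign on either side would take
S below its minimum. -/
theorem exists_isStableInterval_between (hF : Continuous F) (hfin : (zeroComponents F).Finite)
    {x y : ℝ} (hxy : x < y) (hx : F (x : UnitAddCircle) < 0) (hy : 0 < F (y : UnitAddCircle)) :
    ∃ a b : ℝ, x < a ∧ b < y ∧ IsStableInterval F a b := by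
  obtain ⟨m, hm, hmin⟩ := isCompact_Icc.exists_isMinOn (nonempty_Icc.2 hxy.le)
    (continuous_S hF).continuousOn
  have hmin : ∀ s ∈ Icc x y, S F m ≤ S F s := fun s hs => hmin hs
  have hxm : x < m := by
    refine lt_of_le_of_ne hm.1 ?_
    rintro rfl
    have hev : ∀ᶠ s : ℝ in 𝓝[>] x, F (s : UnitAddCircle) < 0 :=
      ((continuous_lift hF).continuousAt.eventually_lt_const hx).filter_mono nhdsWithin_le_nhds
    obtain ⟨u, hu, hIoo⟩ := mem_nhdsGT_iff_exists_Ioo_subset.1 hev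
    have hu' : x < min u y := lt_min hu hxy
    have := S_lt_of_neg hF hu' fun s hs => hIoo ⟨hs.1, hs.2.trans_le (min_le_left _ _)⟩
    exact absurd (hmin _ ⟨hu'.le, min_le_right _ _⟩) this.not_ge
  have hmy : m < y := by
    refine lt_of_le_of_ne hm.2 ?_
    rintro rfl
    have hev : ∀ᶠ s : ℝ in 𝓝[<] m, 0 < F (s : UnitAddCircle) :=
      ((continuous_lift hF).continuousAt.eventually_const_lt hy).filter_mono nhdsWithin_le_nhds
    obtain ⟨u, hu, hIoo⟩ := mem_nhdsLT_iff_exists_Ioo_subset.1 hev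
    have hu' : max u x < m := max_lt hu hxy
    have := S_lt_of_pos hF hu' fun s hs => hIoo ⟨(le_max_left _ _).trans_lt hs.1, hs.2⟩
    exact absurd (hmin _ ⟨le_max_right _ _, hu'.le⟩) this.not_ge
  have hm0 : F (m : UnitAddCircle) = 0 :=
    IsLocalMin.hasDerivAt_eq_zero
      (Filter.mem_of_superset (Icc_mem_nhds hxm hmy) hmin) (hasDerivAt_S hF m)
  obtain ⟨b, hb, hb0, ε, hε, hεy, hbs⟩ := exists_right_end (continuous_lift hF)
    (exists_Ioo_right hfin) hmy hm0 hy.ne'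
  obtain ⟨a, ha, ha0, δ, hδ, hδx, has⟩ := exists_left_end (continuous_lift hF)
    (exists_Ioo_left hfin) hxm hm0 hx.ne
  refine ⟨a, b, ha.1, hb.2, ha.2.trans hb.1, fun s hs => ?_, min δ ε, lt_min hδ hε, ?_, ?_⟩
  · rcases le_total s m with h | h
    · exact ha0 s ⟨hs.1, h⟩
    · exact hb0 s ⟨h, hs.2⟩
  · have hneg := has.resolve_left fun h => by
      have h1 := S_lt_of_pos hF (u := a - δ) (v := a) (by linarith) fun s hs => h s ⟨hs.1.le, hs.2⟩
      have h2 := S_eq_of_eq_zero hF ha.2 fun s hs => ha0 s ⟨hs.1.le, hs.2.le⟩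
      linarith [hmin (a - δ) ⟨hδx.le, by linarith [ha.2]⟩]
    exact fun s hs => hneg s ⟨by linarith [hs.1, min_le_left δ ε], hs.2⟩
  · have hpos := hbs.resolve_right fun h => by
      have h1 := S_lt_of_neg hF (u := b) (v := b + ε) (by linarith) fun s hs => h s ⟨hs.1, hs.2.le⟩
      have h2 := S_eq_of_eq_zero hF hb.1 fun s hs => hb0 s ⟨hs.1.le, hs.2.le⟩
      linarith [hmin (b + ε) ⟨by linarith [hb.1], hεy.le⟩]
    exact fun s hs => hpos s ⟨hs.1, by linarith [hs.2, min_le_right δ ε]⟩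

/-- The peak is the supremum of the points where F > 0, with `c` inserted to cover the case where
there are none. -/
theorem exists_peak {c c' : ℝ} (hcc' : c ≤ c')
    (h : ∀ x ∈ Icc c c', ∀ y ∈ Icc c c', x < y → F (x : UnitAddCircle) < 0 →
      F (y : UnitAddCircle) ≤ 0) :
    ∃ p ∈ Icc c c', (∀ s ∈ Ioo c p, 0 ≤ F (s : UnitAddCircle)) ∧
      ∀ s ∈ Ioo p c', F (s : UnitAddCircle) ≤ 0 := by
  set A : Set ℝ := insert c {s ∈ Icc c c' | 0 < F (s : UnitAddCircle)} with hA
  have hAc' : ∀ s ∈ A, s ≤ c' := by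
    rintro s (rfl | hs)
    · exact hcc'
    · exact hs.1.2
  have hbdd : BddAbove A := ⟨c', hAc'⟩
  have hcA : c ∈ A := mem_insert _ _
  refine ⟨sSup A, ⟨le_csSup hbdd hcA, csSup_le ⟨c, hcA⟩ hAc'⟩, fun s hs => ?_, fun s hs => ?_⟩
  · obtain ⟨t, ht, hst⟩ := exists_lt_of_lt_csSup ⟨c, hcA⟩ hs.2
    by_contra! hneg
    rcases ht with rfl | ht
    · exact absurd hs.1 hst.not_gt
    · exact absurd (h s ⟨hs.1.le, hst.le.trans ht.1.2⟩ t ht.1 hst hneg) ht.2.not_ge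
  · by_contra! hpos
    have : s ∈ A := Or.inr ⟨⟨(le_csSup hbdd hcA).trans hs.1.le, hs.2.le⟩, hpos⟩
    exact absurd (le_csSup hbdd this) hs.1.not_ge

/-! ### Combinatorics of rooted trees on a cycle. -/

theorem sum_ite_sub_le {n : ℕ → ℝ} (hn : Monotone n) (s : Finset ℕ) (a b : ℕ) :
    (∑ k ∈ s, if a ≤ k ∧ k < b then n (k + 1) - n k else 0) ≤ max (n b - n a) 0 := by
  have hd : ∀ k, 0 ≤ n (k + 1) - n k := fun k => sub_nonneg.2 (hn k.le_succ)
  rw [← Finset.sum_filter]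
  have h1 : (∑ k ∈ s with a ≤ k ∧ k < b, (n (k + 1) - n k)) ≤
      ∑ k ∈ Finset.Ico a b, (n (k + 1) - n k) :=
    Finset.sum_le_sum_of_subset_of_nonneg
      (fun k hk => Finset.mem_Ico.2 (Finset.mem_filter.1 hk).2) fun k _ _ => hd k
  refine h1.trans ?_
  rcases le_total a b with hab | hab
  · rw [Finset.sum_Ico_sub n hab]
    exact le_max_left _ _
  · rw [Finset.Ico_eq_empty_of_le hab, Finset.sum_empty]
    exact le_max_right _ _

theorem sum_sub_le_of_cover {n : ℕ → ℝ} (hn : Monotone n) (s J : Finset ℕ) (a b : ℕ → ℕ)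
    (hcov : ∀ k ∈ s, ∃ j ∈ J, a j ≤ k ∧ k < b j) :
    ∑ k ∈ s, (n (k + 1) - n k) ≤ ∑ j ∈ J, max (n (b j) - n (a j)) 0 := by
  have hd : ∀ k, 0 ≤ n (k + 1) - n k := fun k => sub_nonneg.2 (hn k.le_succ)
  calc ∑ k ∈ s, (n (k + 1) - n k)
      ≤ ∑ k ∈ s, ∑ j ∈ J, (if a j ≤ k ∧ k < b j then n (k + 1) - n k else 0) := by
        refine Finset.sum_le_sum fun k hk => ?_
        obtain ⟨j, hj, hjk⟩ := hcov k hk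
        refine le_trans (by rw [if_pos hjk]) (Finset.single_le_sum (f := fun j =>
          if a j ≤ k ∧ k < b j then n (k + 1) - n k else 0) (fun i _ => ?_) hj)
        split_ifs
        exacts [hd k, le_rfl]
    _ = ∑ j ∈ J, ∑ k ∈ s, (if a j ≤ k ∧ k < b j then n (k + 1) - n k else 0) :=
        Finset.sum_comm
    _ ≤ ∑ j ∈ J, max (n (b j) - n (a j)) 0 :=
        Finset.sum_le_sum fun j _ => sum_ite_sub_le hn s (a j) (b j)

/-- If every `1 ≤ j < l` escapes to `0` or `l` along `f`, the jumps `j → f j` cover everything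
except one gap. -/
theorem exists_cut_le_sum {l : ℕ} (hl : 0 < l) {p n : ℕ → ℝ} (hp : Monotone p) (hn : Monotone n)
    (f : ℕ → ℕ)
    (hesc : ∀ a b, 1 ≤ a → a ≤ b → b < l → ∃ j, a ≤ j ∧ j ≤ b ∧ (f j < a ∨ b < f j)) :
    ∃ c < l, n c - n 0 + (p l - p (c + 1)) ≤
      ∑ j ∈ Finset.Ico 1 l, (max (p (f j) - p j) 0 + max (n j - n (f j)) 0) := by
  classical
  -- The cut `c` is the first unit edge crossed by no leftward jump; the disjunct `l ≤ c + 1`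
  -- selects the last edge when there is none.
  have hex : ∃ c, l ≤ c + 1 ∨ ¬ ∃ j ∈ Finset.Ico 1 l, f j ≤ c ∧ c < j := ⟨l, Or.inl (by omega)⟩
  refine ⟨Nat.find hex, ?_, ?_⟩
  · have : Nat.find hex ≤ l - 1 := Nat.find_min' hex (Or.inl (by omega))
    omega
  have hc : Nat.find hex < l := by
    have : Nat.find hex ≤ l - 1 := Nat.find_min' hex (Or.inl (by omega))
    omega
  -- By minimality every edge before the cut is crossed leftwards, so the `n`-costs pay for all of
  -- them.
  have hleft := sum_sub_le_of_cover hn (Finset.range (Nat.find hex)) (Finset.Ico 1 l) f id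
    fun k hk => by
      have h := Nat.find_min hex (Finset.mem_range.1 hk)
      push Not at h
      exact h.2
  -- Some jump escapes the block from `c + 1` to `k`. It cannot go left across the cut, so it goes
  -- right past `k`, and the `p`-costs pay for the edge `k`.
  have hright := sum_sub_le_of_cover hp (Finset.Ico (Nat.find hex + 1) l) (Finset.Ico 1 l) id f
    fun k hk => by
      obtain ⟨hk1, hk2⟩ := Finset.mem_Ico.1 hk
      obtain ⟨j, hj1, hj2, h⟩ := hesc (Nat.find hex + 1) k (by omega) hk1 hk2
      refine ⟨j, Finset.mem_Ico.2 ⟨by omega, by omega⟩, hj2, h.resolve_left fun h => ?_⟩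
      rcases Nat.find_spec hex with h' | h'
      · omega
      · exact h' ⟨j, Finset.mem_Ico.2 ⟨by omega, by omega⟩, by omega, by omega⟩
  rw [Finset.sum_range_sub] at hleft
  rw [Finset.sum_Ico_sub p (by omega)] at hright
  rw [Finset.sum_add_distrib]
  simp only [id] at hleft hright
  linarith

/-- Each vertex other than the root has a unique outgoing arrow, which becomes a jump on {0, …, l}.
The index `k'` allows for paths that leave the period: they are stopped at `0` or `l`, both copies
of the root. -/
theorem exists_cut_le_tree {ι : Type*} {l : ℕ} (hl : 0 < l) (e : ℕ → ι)
    (hinj : InjOn e (Iio l)) (hsurj : ∀ x, ∃ k < l, e k = x) {p n : ℕ → ℝ} (hp : Monotone p)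
    (hn : Monotone n) {w : ι × ι → ℝ} (hw : ∀ q, 0 ≤ w q)
    (hcost : ∀ j < l, ∀ k < l, ∃ k', (k' = k ∨ k' = 0 ∨ k' = l) ∧
      max (p k' - p j) 0 + max (n j - n k') 0 ≤ w (e j, e k))
    {g : Finset (ι × ι)} (hg : g ∈ rootedTrees ι (e 0)) :
    ∃ c < l, n c - n 0 + (p l - p (c + 1)) ≤ ∑ q ∈ g, w q := by
  classical
  obtain ⟨huniq, hreach, -⟩ := hg
  have hne : ∀ j, 1 ≤ j → j < l → e j ≠ e 0 := fun j hj hjl h => by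
    have := hinj hjl hl h
    omega
  have hstep : ∀ j, ∃ k k', 1 ≤ j → j < l → k < l ∧ (e j, e k) ∈ g ∧ (k' = k ∨ k' = 0 ∨ k' = l) ∧
      max (p k' - p j) 0 + max (n j - n k') 0 ≤ w (e j, e k) := by
    intro j
    by_cases hj : 1 ≤ j ∧ j < l
    · obtain ⟨x, hx, -⟩ := huniq (e j) (hne j hj.1 hj.2)
      obtain ⟨k, hk, rfl⟩ := hsurj x
      obtain ⟨k', h1, h2⟩ := hcost j hj.2 k hk
      exact ⟨k, k', fun _ _ => ⟨hk, hx, h1, h2⟩⟩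
    · exact ⟨0, 0, fun h1 h2 => absurd ⟨h1, h2⟩ hj⟩
  choose k f hkf using hstep
  obtain ⟨c, hc, hle⟩ := exists_cut_le_sum hl hp hn f (by
    intro a b ha hab hb
    by_contra! hcon
    -- A block with no escape contains neither `0` nor `l`, so its jumps are the actual arrows. It
    -- is then closed under arrows, and the root is never reached.
    have hclosed : ∀ y, Relation.ReflTransGen (fun m n : ι => (m, n) ∈ g) (e a) y →
        ∃ j, a ≤ j ∧ j ≤ b ∧ y = e j := by
      intro y hy
      induction hy with
      | refl => exact ⟨a, le_rfl, hab, rfl⟩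
      | tail _ hyz ih =>
        obtain ⟨j, hj1, hj2, rfl⟩ := ih
        obtain ⟨-, h1, h2, -⟩ := hkf j (by omega) (by omega)
        obtain ⟨h3, h4⟩ := hcon j hj1 hj2
        have h5 : f j = k j := by omega
        exact ⟨f j, h3, h4, (huniq (e j) (hne j (by omega) (by omega))).unique hyz (h5 ▸ h1)⟩
    obtain ⟨j, hj1, hj2, h⟩ := hclosed _ (hreach (e a) (hne a ha (by omega)))
    exact hne j (by omega) (by omega) h.symm)
  refine ⟨c, hc, hle.trans ?_⟩
  have hinj' : InjOn (fun j => (e j, e (k j))) (Finset.Ico 1 l : Set ℕ) := by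
    intro i hi j hj hij
    exact hinj (Finset.mem_Ico.1 hi).2 (Finset.mem_Ico.1 hj).2 (congrArg Prod.fst hij)
  calc _ ≤ ∑ j ∈ Finset.Ico 1 l, w (e j, e (k j)) := Finset.sum_le_sum fun j hj =>
        (hkf j (Finset.mem_Ico.1 hj).1 (Finset.mem_Ico.1 hj).2).2.2.2
    _ = ∑ q ∈ (Finset.Ico 1 l).image fun j => (e j, e (k j)), w q :=
        (Finset.sum_image hinj').symm
    _ ≤ ∑ q ∈ g, w q := by
        refine Finset.sum_le_sum_of_subset_of_nonneg ?_ fun q _ _ => hw q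
        intro q hq
        obtain ⟨j, hj, rfl⟩ := Finset.mem_image.1 hq
        exact (hkf j (Finset.mem_Ico.1 hj).1 (Finset.mem_Ico.1 hj).2).2.1

/-- On a cycle, cutting the edge from `e c` to `e (c + 1)` leaves a tree rooted at `e 0`. -/
theorem exists_tree_of_cut {ι : Type*} {l : ℕ} (e : ℕ → ι) (hinj : InjOn e (Iio l))
    (hsurj : ∀ x, ∃ k < l, e k = x) (hel : e l = e 0) {c : ℕ} (hc : c < l) (w : ι × ι → ℝ) :
    ∃ g ∈ rootedTrees ι (e 0), ∑ q ∈ g, w q =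
      ∑ k ∈ Finset.range c, w (e (k + 1), e k) + ∑ k ∈ Finset.Ico (c + 1) l, w (e k, e (k + 1)) := by
  classical
  -- Vertices up to the cut step down to `0`, the others step up to `l`, which is again the root by
  -- `hel`.
  set next : ℕ → ℕ := fun j => if j ≤ c then j - 1 else j + 1 with hnext
  have hmem : ∀ j, 1 ≤ j → j < l →
      (e j, e (next j)) ∈ (Finset.Ico 1 l).image fun j => (e j, e (next j)) := fun j h1 h2 =>
    Finset.mem_image_of_mem (fun j => (e j, e (next j))) (Finset.mem_Ico.2 ⟨h1, h2⟩)
  refine ⟨(Finset.Ico 1 l).image fun j => (e j, e (next j)), ⟨?_, ?_, ?_⟩, ?_⟩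
  · intro x hx
    obtain ⟨k, hk, rfl⟩ := hsurj x
    have hk1 : 1 ≤ k := Nat.one_le_iff_ne_zero.2 fun h => hx (h ▸ rfl)
    refine ⟨e (next k), hmem k hk1 hk, fun y hy => ?_⟩
    obtain ⟨j, hj, h⟩ := Finset.mem_image.1 hy
    obtain ⟨h1, h2⟩ := Prod.mk.inj h
    rw [← h2, hinj (Finset.mem_Ico.1 hj).2 hk h1]
  · have hleft : ∀ k ≤ c, Relation.ReflTransGen
        (fun m n : ι => (m, n) ∈ (Finset.Ico 1 l).image fun j => (e j, e (next j))) (e k) (e 0) := by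
      intro k
      induction k with
      | zero => exact fun _ => Relation.ReflTransGen.refl
      | succ k ih =>
        intro hk
        refine Relation.ReflTransGen.head ?_ (ih (by omega))
        have h := hmem (k + 1) (by omega) (by omega)
        simp only [hnext, if_pos hk, Nat.add_sub_cancel] at h ⊢
        exact h
    have hright : ∀ d k, k + d = l → c < k → Relation.ReflTransGen
        (fun m n : ι => (m, n) ∈ (Finset.Ico 1 l).image fun j => (e j, e (next j))) (e k) (e 0) := by
      intro d
      induction d with
      | zero =>
        rintro k rfl -
        exact hel ▸ Relation.ReflTransGen.refl
      | succ d ih =>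
        intro k hk hck
        refine Relation.ReflTransGen.head ?_ (ih (k + 1) (by omega) (by omega))
        have h := hmem k (by omega) (by omega)
        simp only [hnext, if_neg hck.not_ge] at h ⊢
        exact h
    intro x _
    obtain ⟨k, hk, rfl⟩ := hsurj x
    rcases le_or_gt k c with hkc | hkc
    · exact hleft k hkc
    · exact hright (l - k) k (by omega) hkc
  · intro y hy
    obtain ⟨j, hj, h⟩ := Finset.mem_image.1 hy
    obtain ⟨h1, h2⟩ := Finset.mem_Ico.1 hj
    have := hinj h2 (show (0 : ℕ) ∈ Iio l from (Nat.zero_le c).trans_lt hc) (Prod.mk.inj h).1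
    omega
  · rw [Finset.sum_image (fun i hi j hj hij =>
      hinj (Finset.mem_Ico.1 hi).2 (Finset.mem_Ico.1 hj).2 (congrArg Prod.fst hij)),
      ← Finset.sum_Ico_consecutive _ (show 1 ≤ c + 1 by omega) (show c + 1 ≤ l by omega)]
    congr 1
    · rw [Finset.sum_Ico_eq_sum_range]
      refine Finset.sum_congr rfl fun k hk => ?_
      have := Finset.mem_range.1 hk
      rw [add_comm 1 k]
      simp only [hnext, if_pos (show k + 1 ≤ c by omega), Nat.add_sub_cancel]
    · refine Finset.sum_congr rfl fun k hk => ?_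
      have := Finset.mem_Ico.1 hk
      simp only [hnext, if_neg (show ¬ k ≤ c by omega)]

/-! ### Lifts of stable components and their cyclic enumeration. -/

theorem image_coe_Icc_add_int (a b : ℝ) (k : ℤ) :
    (fun s : ℝ => (s : UnitAddCircle)) '' Icc (a + k) (b + k) =
      (fun s : ℝ => (s : UnitAddCircle)) '' Icc a b := by
  ext z
  constructor
  · rintro ⟨s, hs, rfl⟩
    refine ⟨s - k, ⟨by linarith [hs.1], by linarith [hs.2]⟩, ?_⟩
    change ((s - k : ℝ) : UnitAddCircle) = (s : UnitAddCircle)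
    rw [← coe_add_int (s - k) k, sub_add_cancel]
  · rintro ⟨s, hs, rfl⟩
    exact ⟨s + k, ⟨by linarith [hs.1], by linarith [hs.2]⟩, coe_add_int s k⟩

theorem IsStableInterval.add_int {a b : ℝ} (h : IsStableInterval F a b) (k : ℤ) :
    IsStableInterval F (a + k) (b + k) := by
  have e : ∀ s : ℝ, ((s - k : ℝ) : UnitAddCircle) = (s : UnitAddCircle) := fun s => by
    rw [← coe_add_int (s - k) k, sub_add_cancel]
  obtain ⟨ε, hε, hneg, hpos⟩ := h.sign
  refine ⟨by linarith [h.le], fun s hs => ?_, ε, hε, fun s hs => ?_, fun s hs => ?_⟩ <;>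
    rw [← e s]
  · exact h.zero _ ⟨by linarith [hs.1], by linarith [hs.2]⟩
  · exact hneg _ ⟨by linarith [hs.1], by linarith [hs.2]⟩
  · exact hpos _ ⟨by linarith [hs.1], by linarith [hs.2]⟩

theorem IsStableInterval.right_le {a b b' : ℝ} (h : IsStableInterval F a b)
    (h' : IsStableInterval F a b') : b' ≤ b := by
  by_contra! hlt
  obtain ⟨ε, hε, -, hpos⟩ := h.sign
  have h1 : b < min (b + ε) b' := lt_min (by linarith) hlt
  exact (hpos _ ⟨h1, min_le_left _ _⟩).ne'
    (h'.zero _ ⟨h.le.trans h1.le, min_le_right _ _⟩)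

/-- The left end of one interval corresponds to a point of the other, and that point must be its
left end because F < 0 immediately before it. -/
theorem IsStableInterval.exists_int {a b a' b' : ℝ} (h : IsStableInterval F a b)
    (h' : IsStableInterval F a' b')
    (e : (fun s : ℝ => (s : UnitAddCircle)) '' Icc a b =
      (fun s : ℝ => (s : UnitAddCircle)) '' Icc a' b') : ∃ k : ℤ, a' = a + k := by
  obtain ⟨s, hs, es⟩ : (a' : UnitAddCircle) ∈ (fun s : ℝ => (s : UnitAddCircle)) '' Icc a b := by
    rw [e]
    exact ⟨a', ⟨le_rfl, h'.le⟩, rfl⟩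
  obtain ⟨k, hk⟩ := exists_int_of_coe_eq es.symm
  rcases hs.1.eq_or_lt with rfl | hlt
  · exact ⟨k, hk⟩
  · exfalso
    obtain ⟨ε, hε, hneg, -⟩ := (h'.add_int (-k)).sign
    push_cast at hneg
    rw [hk] at hneg
    have h1 : max (s - ε) a < s := max_lt (by linarith) hlt
    exact (hneg (max (s - ε) a) ⟨by linarith [le_max_left (s - ε) a], by linarith⟩).ne
      (h.zero _ ⟨le_max_right _ _, h1.le.trans hs.2⟩)

theorem exists_add_int_mem_Ico (a x : ℝ) :
    ∃ k : ℤ, a + k ∈ Ico x (x + 1) := by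
  refine ⟨-⌊a - x⌋, ?_, ?_⟩
  · have := Int.floor_le (a - x)
    push_cast
    linarith
  · have := Int.lt_floor_add_one (a - x)
    push_cast
    linarith

/-- `t 0 < t 1 < ⋯ < t l = t 0 + 1` are the left ends of the lifts of the stable components
between `t 0` and `t 0 + 1`. -/
structure IsStableEnumeration (F : UnitAddCircle → ℝ) (l : ℕ) (t b : ℕ → ℝ)
    (e : ℕ → stableComponents F) : Prop where
  pos : 0 < l
  mono : Monotone t
  last : t l = t 0 + 1
  lt_last : ∀ k < l, t k < t 0 + 1
  interval : ∀ k, IsStableInterval F (t k) (b k)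
  coe_eq : ∀ k, (e k : Set UnitAddCircle) =
    (fun s : ℝ => (s : UnitAddCircle)) '' Icc (t k) (b k)
  injOn : InjOn e (Iio l)
  surj : ∀ K, ∃ k < l, e k = K
  e_last : e l = e 0
  gap : ∀ k < l, ∀ a c, IsStableInterval F a c → t k < a → t (k + 1) ≤ a

theorem finite_stableComponents (hfin : (zeroComponents F).Finite) :
    (stableComponents F).Finite :=
  hfin.subset fun _ h => h.1

theorem exists_isStableEnumeration (hfin : (zeroComponents F).Finite) {a₀ b₀ : ℝ}
    (h₀ : IsStableInterval F a₀ b₀) :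
    ∃ (l : ℕ) (t b : ℕ → ℝ) (e : ℕ → stableComponents F),
      IsStableEnumeration F l t b e ∧ t 0 = a₀ := by
  classical
  set A : Set ℝ := {a ∈ Ico a₀ (a₀ + 1) | ∃ b, IsStableInterval F a b} with hA
  have hAinj : ∀ a ∈ Ico a₀ (a₀ + 1), ∀ a' ∈ Ico a₀ (a₀ + 1), ∀ b b', IsStableInterval F a b →
      IsStableInterval F a' b' → (fun s : ℝ => (s : UnitAddCircle)) '' Icc a b =
        (fun s : ℝ => (s : UnitAddCircle)) '' Icc a' b' → a = a' := by
    intro a ha a' ha' b b' h h' e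
    obtain ⟨k, rfl⟩ := h.exists_int h' e
    exact coe_injOn_Ico ha ha' (coe_add_int a k).symm
  have hAfin : A.Finite := by
    have hex : ∀ a : ℝ, ∃ b, a ∈ A → IsStableInterval F a b := fun a => by
      by_cases h : a ∈ A
      · obtain ⟨b, hb⟩ := h.2
        exact ⟨b, fun _ => hb⟩
      · exact ⟨0, fun h' => absurd h' h⟩
    choose β hβ using hex
    refine Set.Finite.of_finite_image (f := fun a =>
      (fun s : ℝ => (s : UnitAddCircle)) '' Icc a (β a))
      ((finite_stableComponents hfin).subset ?_) ?_
    · rintro _ ⟨a, ha, rfl⟩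
      exact (hβ a ha).mem_stableComponents
    · intro a ha a' ha' e
      exact hAinj a ha.1 a' ha'.1 _ _ (hβ a ha) (hβ a' ha') e
  set T := hAfin.toFinset with hT
  have ha₀ : a₀ ∈ T := by
    rw [hT, Finite.mem_toFinset]
    exact ⟨⟨le_rfl, by linarith⟩, b₀, h₀⟩
  have hTpos : 0 < T.card := Finset.card_pos.2 ⟨a₀, ha₀⟩
  set τ := T.orderEmbOfFin rfl with hτ
  have hτA : ∀ i, τ i ∈ A := fun i =>
    hAfin.mem_toFinset.1 (T.orderEmbOfFin_mem rfl i)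
  have hτsurj : ∀ a ∈ A, ∃ i, τ i = a := fun a ha => by
    have : a ∈ range τ := by
      rw [hτ, Finset.range_orderEmbOfFin, Finset.mem_coe, hT, Finite.mem_toFinset]
      exact ha
    exact this
  -- The default `a₀ + 1` makes `t` monotone on all of `ℕ` and gives `t l = t 0 + 1` at `l =
  -- T.card`.
  set t : ℕ → ℝ := fun k => if h : k < T.card then τ ⟨k, h⟩ else a₀ + 1 with ht
  have ht1 : ∀ k (h : k < T.card), t k = τ ⟨k, h⟩ := fun k h => dif_pos h
  have ht2 : ∀ k, ¬ k < T.card → t k = a₀ + 1 := fun k h => dif_neg h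
  have hint : ∀ k, ∃ b, IsStableInterval F (t k) b := fun k => by
    by_cases h : k < T.card
    · rw [ht1 k h]
      exact (hτA _).2
    · rw [ht2 k h]
      have := h₀.add_int 1
      push_cast at this
      exact ⟨_, this⟩
  choose b hb using hint
  have ht0 : t 0 = a₀ := by
    obtain ⟨i, hi⟩ := hτsurj a₀ ⟨⟨le_rfl, by linarith⟩, b₀, h₀⟩
    rw [ht1 0 hTpos]
    refine le_antisymm ?_ (hτA _).1.1
    rw [← hi]
    exact τ.monotone (Nat.zero_le i)
  have hmem : ∀ k < T.card, t k ∈ Ico a₀ (a₀ + 1) := fun k h => by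
    rw [ht1 k h]
    exact (hτA _).1
  have hlast : t T.card = a₀ + 1 := ht2 _ (lt_irrefl _)
  refine ⟨T.card, t, b, fun k => ⟨_, (hb k).mem_stableComponents⟩,
    ⟨hTpos, ?_, ?_, ?_, hb, fun _ => rfl, ?_, ?_, ?_, ?_⟩, ht0⟩
  · refine monotone_nat_of_le_succ fun k => ?_
    by_cases h : k + 1 < T.card
    · rw [ht1 _ h, ht1 k (by omega)]
      exact τ.monotone (Fin.mk_le_mk.2 k.le_succ)
    · rw [ht2 _ h]
      by_cases h' : k < T.card
      · exact (hmem k h').2.le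
      · exact (ht2 k h').le
  · rw [hlast, ht0]
  · intro k hk
    rw [ht0]
    exact (hmem k hk).2
  · intro i hi j hj hij
    have := hAinj _ (hmem i hi) _ (hmem j hj) _ _ (hb i) (hb j) (congrArg Subtype.val hij)
    rw [ht1 i hi, ht1 j hj] at this
    exact congrArg Fin.val (τ.injective this)
  · rintro ⟨K, hK⟩
    obtain ⟨a, c, rfl, hac⟩ := exists_isStableInterval hK
    obtain ⟨k, hk⟩ := exists_add_int_mem_Ico a a₀
    obtain ⟨i, hi⟩ := hτsurj (a + k) ⟨hk, c + k, hac.add_int k⟩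
    refine ⟨i, i.2, Subtype.ext ?_⟩
    have hti : t i = a + k := by rw [ht1 i i.2, ← hi]
    have hbi := hb i
    rw [hti] at hbi
    change (fun s : ℝ => (s : UnitAddCircle)) '' Icc (t i) (b i) = _
    rw [hti, le_antisymm ((hac.add_int k).right_le hbi) (hbi.right_le (hac.add_int k)),
      image_coe_Icc_add_int]
  · refine Subtype.ext ?_
    have h1 := (hb 0).add_int 1
    have h2 := hb T.card
    rw [hlast] at h2
    rw [ht0] at h1
    push_cast at h1
    change (fun s : ℝ => (s : UnitAddCircle)) '' Icc (t T.card) (b T.card) =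
      (fun s : ℝ => (s : UnitAddCircle)) '' Icc (t 0) (b 0)
    have h3 := image_coe_Icc_add_int a₀ (b 0) 1
    push_cast at h3
    rw [hlast, le_antisymm (h1.right_le h2) (h2.right_le h1), ht0, h3]
  · intro k hk a c hac hka
    by_contra! hlt
    have hle : t (k + 1) ≤ a₀ + 1 := by
      by_cases h : k + 1 < T.card
      · exact (hmem _ h).2.le
      · exact (ht2 _ h).le
    have haA : a ∈ A := ⟨⟨(hmem k hk).1.trans hka.le, hlt.trans_le hle⟩, c, hac⟩
    obtain ⟨i, rfl⟩ := hτsurj a haA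
    rw [ht1 k hk] at hka
    have h1 : k < i := Fin.lt_def.1 (τ.lt_iff_lt.1 hka)
    have h2 : k + 1 < T.card := by omega
    rw [ht1 _ h2] at hlt
    have h3 : (i : ℕ) < k + 1 := Fin.lt_def.1 (τ.lt_iff_lt.1 hlt)
    omega

/-! ### Computation of `WComp` and comparison of `W` with `Phi`. -/

theorem VSet_le (hF : Continuous F) {A B : Set UnitAddCircle} {x y : UnitAddCircle} (hx : x ∈ A)
    (hy : y ∈ B) : VSet F A B ≤ V F x y := by
  refine csInf_le ⟨0, ?_⟩ ⟨x, hx, y, hy, rfl⟩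
  rintro _ ⟨x, -, y, -, rfl⟩
  exact V_nonneg hF x y

theorem VSet_nonneg (hF : Continuous F) (A B : Set UnitAddCircle) : 0 ≤ VSet F A B := by
  refine Real.sInf_nonneg ?_
  rintro _ ⟨x, -, y, -, rfl⟩
  exact V_nonneg hF x y

/-- Moving inside a component costs nothing, so by the triangle inequality the left ends already
achieve the infimum. -/
theorem IsStableInterval.V_le_VSet (hF : Continuous F) {a b a' b' : ℝ}
    (h : IsStableInterval F a b) (h' : IsStableInterval F a' b') :
    V F (a : UnitAddCircle) (a' : UnitAddCircle) ≤
      VSet F ((fun s : ℝ => (s : UnitAddCircle)) '' Icc a b)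
        ((fun s : ℝ => (s : UnitAddCircle)) '' Icc a' b') := by
  refine le_csInf ⟨_, a, ⟨a, ⟨le_rfl, h.le⟩, rfl⟩, a', ⟨a', ⟨le_rfl, h'.le⟩, rfl⟩, rfl⟩ ?_
  rintro _ ⟨_, ⟨s, hs, rfl⟩, _, ⟨s', hs', rfl⟩, rfl⟩
  have h1 := V_triangle hF (a : UnitAddCircle) (s : UnitAddCircle) (a' : UnitAddCircle)
  have h2 := V_triangle hF (s : UnitAddCircle) (s' : UnitAddCircle) (a' : UnitAddCircle)
  have h3 := V_coe_eq_zero hF h.zero ⟨le_rfl, h.le⟩ hs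
  have h4 := V_coe_eq_zero hF h'.zero hs' ⟨le_rfl, h'.le⟩
  linarith

theorem IsStableInterval.Phi_le_Phi_add_VSet (hF : Continuous F) {a b : ℝ}
    (h : IsStableInterval F a b) (x : ℝ) :
    Phi F x ≤ Phi F a +
      VSet F ((fun s : ℝ => (s : UnitAddCircle)) '' Icc a b) {(x : UnitAddCircle)} := by
  suffices h : Phi F x - Phi F a ≤
      VSet F ((fun s : ℝ => (s : UnitAddCircle)) '' Icc a b) {(x : UnitAddCircle)} by linarith
  refine le_csInf ⟨_, a, ⟨a, ⟨le_rfl, h.le⟩, rfl⟩, _, rfl, rfl⟩ ?_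
  rintro _ ⟨_, ⟨s, hs, rfl⟩, _, rfl, rfl⟩
  have h1 := Phi_le_Phi_add_V hF x s
  have h2 := Phi_le_Phi_add_V hF s a
  have h3 := V_coe_eq_zero hF h.zero ⟨le_rfl, h.le⟩ hs
  linarith

namespace IsStableEnumeration

variable {l : ℕ} {t b : ℕ → ℝ} {e : ℕ → stableComponents F}

theorem exists_between (h : IsStableEnumeration F l t b e) {x : ℝ}
    (hx : x ∈ Icc (t 0) (t 0 + 1)) : ∃ c < l, x ∈ Icc (t c) (t (c + 1)) := by
  have hex : ∃ k, x ≤ t (k + 1) := ⟨l, hx.2.trans (h.last ▸ h.mono l.le_succ)⟩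
  classical
  refine ⟨Nat.find hex, ?_, ?_, Nat.find_spec hex⟩
  · have hl := h.pos
    have := Nat.find_min' hex (m := l - 1) (by
      rw [Nat.sub_add_cancel hl, h.last]
      exact hx.2)
    omega
  · rcases Nat.eq_zero_or_pos (Nat.find hex) with h0 | h0
    · rw [h0]
      exact hx.1
    · have := Nat.find_min hex (m := Nat.find hex - 1) (by omega)
      rw [Nat.sub_add_cancel h0] at this
      exact (not_le.1 this).le

/-- A change from negative to positive between consecutive lifts would create a further stable
interval there, against `gap`. -/
theorem exists_peak (hF : Continuous F) (hfin : (zeroComponents F).Finite)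
    (h : IsStableEnumeration F l t b e) {c : ℕ} (hc : c < l) :
    ∃ p ∈ Icc (t c) (t (c + 1)), (∀ s ∈ Ioo (t c) p, 0 ≤ F (s : UnitAddCircle)) ∧
      ∀ s ∈ Ioo p (t (c + 1)), F (s : UnitAddCircle) ≤ 0 := by
  refine CircleLD.exists_peak (h.mono c.le_succ) fun x hx y hy hxy hFx => ?_
  by_contra! hFy
  obtain ⟨a, d, hxa, hdy, had⟩ := exists_isStableInterval_between hF hfin hxy hFx hFy
  have := h.gap c hc a d had (hx.1.trans_lt hxa)
  linarith [had.le, hy.2]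

theorem succ_le (h : IsStableEnumeration F l t b e) {c : ℕ} (hc : c < l) :
    t (c + 1) ≤ t 0 + 1 :=
  (h.mono hc).trans_eq h.last

/-- The optimal lift of the target may lie outside [t₀, t₀ + 1); stopping the path at `t 0` or `t l`
makes it no more expensive. -/
theorem exists_VReal_le_VSet (hF : Continuous F) (h : IsStableEnumeration F l t b e) {j k : ℕ}
    (hj : j < l) (hk : k < l) :
    ∃ k', (k' = k ∨ k' = 0 ∨ k' = l) ∧ VReal F (t j) (t k') ≤ VSet F (e j) (e k) := by
  have h1 := (h.interval j).V_le_VSet hF (h.interval k)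
  rw [← h.coe_eq, ← h.coe_eq] at h1
  obtain ⟨w, -, ew, hw⟩ := exists_V_coe_eq hF (t j) (t k)
  rw [hw] at h1
  have h0k := h.mono (Nat.zero_le k)
  have h0j := h.mono (Nat.zero_le j)
  have hjl := h.lt_last j hj
  rcases lt_or_ge w (t 0) with hw0 | hw0
  · refine ⟨0, by simp, h1.trans' ?_⟩
    rw [VReal_of_ge hF h0j, VReal_of_ge hF (hw0.le.trans h0j)]
    linarith [monotone_primNeg hF hw0.le]
  · rcases lt_or_ge w (t 0 + 1) with hw1 | hw1
    · have := coe_injOn_Ico ⟨hw0, hw1⟩ ⟨h0k, h.lt_last k hk⟩ ew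
      exact ⟨k, by simp, this ▸ h1⟩
    · refine ⟨l, by simp, h1.trans' ?_⟩
      rw [h.last, VReal_of_le hF hjl.le, VReal_of_le hF (hjl.le.trans hw1)]
      linarith [monotone_primPos hF hw1]

theorem le_sum_of_mem_rootedTrees (hF : Continuous F) (hfin : (zeroComponents F).Finite)
    (h : IsStableEnumeration F l t b e)
    {g : Finset (stableComponents F × stableComponents F)}
    (hg : g ∈ rootedTrees (stableComponents F) (e 0)) :
    primPos F 1 + Phi F (t 0) ≤ ∑ q ∈ g, VSet F (q.1 : Set UnitAddCircle) q.2 := by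
  obtain ⟨c, hc, hle⟩ := exists_cut_le_tree h.pos e h.injOn h.surj
    (p := fun k => primPos F (t k)) (n := fun k => primNeg F (t k))
    (fun i j hij => monotone_primPos hF (h.mono hij))
    (fun i j hij => monotone_primNeg hF (h.mono hij))
    (w := fun q => VSet F (q.1 : Set UnitAddCircle) q.2) (fun q => VSet_nonneg hF _ _)
    (fun j hj k hk => h.exists_VReal_le_VSet hF hj hk) hg
  refine hle.trans' ?_
  -- The peak of the cut gap turns the bound into `P(1) + S(t₀) - S(p)`, and `p` is admissible in
  -- the minimum defining `Phi F (t 0)`.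
  obtain ⟨p, hp, hpos, hneg⟩ := h.exists_peak hF hfin hc
  have h1 := primPos_eq_of_nonpos hF hp.2 hneg
  have h2 := primNeg_eq_of_nonneg hF hp.1 hpos
  have h3 : primPos F (t 0 + 1) = _ := S_add_one (continuous_posPart hF) (t 0)
  have h4 := Phi_le hF (x := t 0) (y := p)
    ⟨(h.mono c.zero_le).trans hp.1, hp.2.trans (h.succ_le hc)⟩
  have h5 := primPos_sub_primNeg hF p
  have h6 := primPos_sub_primNeg hF (t 0)
  simp only [h.last]
  change primPos F (t 0 + 1) = primPos F (t 0) + primPos F 1 at h3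
  linarith

/-- Cut the cycle at the gap containing a maximizer `y` of S on [t₀, t₀ + 1]; monotonicity of both
primitives then compares the gap ends with `y`. -/
theorem exists_tree_sum_le (hF : Continuous F) (h : IsStableEnumeration F l t b e) :
    ∃ g ∈ rootedTrees (stableComponents F) (e 0),
      ∑ q ∈ g, VSet F (q.1 : Set UnitAddCircle) q.2 ≤ primPos F 1 + Phi F (t 0) := by
  obtain ⟨y, hy, ey, -⟩ := exists_Phi_eq hF (t 0)
  obtain ⟨c, hc, hcy⟩ := h.exists_between hy
  obtain ⟨g, hg, eg⟩ := exists_tree_of_cut e h.injOn h.surj h.e_last hc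
    (fun q => VSet F (q.1 : Set UnitAddCircle) q.2)
  refine ⟨g, hg, eg.trans_le ?_⟩
  have hV : ∀ i j, VSet F (e i) (e j) ≤ VReal F (t i) (t j) := fun i j => by
    refine (VSet_le hF ?_ ?_).trans (V_coe_le_VReal hF (t i) (t j)) <;> rw [h.coe_eq]
    exacts [⟨_, ⟨le_rfl, (h.interval i).le⟩, rfl⟩, ⟨_, ⟨le_rfl, (h.interval j).le⟩, rfl⟩]
  have h1 : ∑ k ∈ Finset.range c, VSet F (e (k + 1)) (e k) ≤
      ∑ k ∈ Finset.range c, (primNeg F (t (k + 1)) - primNeg F (t k)) :=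
    Finset.sum_le_sum fun k _ =>
      (hV _ _).trans_eq (VReal_of_ge hF (h.mono k.le_succ))
  have h2 : ∑ k ∈ Finset.Ico (c + 1) l, VSet F (e k) (e (k + 1)) ≤
      ∑ k ∈ Finset.Ico (c + 1) l, (primPos F (t (k + 1)) - primPos F (t k)) :=
    Finset.sum_le_sum fun k _ =>
      (hV _ _).trans_eq (VReal_of_le hF (h.mono k.le_succ))
  rw [Finset.sum_range_sub fun k => primNeg F (t k)] at h1
  rw [Finset.sum_Ico_sub (fun k => primPos F (t k)) hc, h.last] at h2
  have h3 : primPos F (t 0 + 1) = primPos F (t 0) + primPos F 1 :=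
    S_add_one (continuous_posPart hF) (t 0)
  have h5 := primPos_sub_primNeg hF y
  have h6 := primPos_sub_primNeg hF (t 0)
  have h7 := monotone_primNeg hF hcy.1
  have h8 := monotone_primPos hF hcy.2
  linarith

theorem WComp_eq (hF : Continuous F) (hfin : (zeroComponents F).Finite)
    (h : IsStableEnumeration F l t b e) : WComp F (e 0) = primPos F 1 + Phi F (t 0) := by
  obtain ⟨g, hg, hle⟩ := h.exists_tree_sum_le hF
  have hlow : ∀ r ∈ (fun g : Finset (stableComponents F × stableComponents F) =>
      ∑ p ∈ g, VSet F (p.1 : Set UnitAddCircle) (p.2 : Set UnitAddCircle)) ''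
        rootedTrees (stableComponents F) (e 0), primPos F 1 + Phi F (t 0) ≤ r := by
    rintro _ ⟨g, hg, rfl⟩
    exact h.le_sum_of_mem_rootedTrees hF hfin hg
  exact le_antisymm ((csInf_le ⟨_, hlow⟩ ⟨g, hg, rfl⟩).trans hle) (le_csInf ⟨_, g, hg, rfl⟩ hlow)

end IsStableEnumeration

/-- Any stable lift can serve as the start of an enumeration, which makes its component the root. -/
theorem WComp_eq (hF : Continuous F) (hfin : (zeroComponents F).Finite)
    (K : stableComponents F) {a b : ℝ} (h : IsStableInterval F a b)
    (hK : (K : Set UnitAddCircle) = (fun s : ℝ => (s : UnitAddCircle)) '' Icc a b) :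
    WComp F K = primPos F 1 + Phi F a := by
  obtain ⟨l, t, b', e, he, rfl⟩ := exists_isStableEnumeration hfin h
  have : K = e 0 := Subtype.ext (by
    rw [hK, he.coe_eq, le_antisymm ((he.interval 0).right_le h) (h.right_le (he.interval 0))])
  rw [this, he.WComp_eq hF hfin]

/-- Let `x` lie before the peak `p`. If the maximizer `z` is still in the window of `t c`, the rise
from `t c` to `x` accounts for the cost exactly. Otherwise S does not decrease from `z` to `x + 1`,
so Φ(x) ≥ -S(1), and testing with `p + 1` bounds the cost from `t (c + 1)`. After the peak the roles
are exchanged. -/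
theorem IsStableEnumeration.exists_Phi_add_VReal_le (hF : Continuous F)
    (hfin : (zeroComponents F).Finite) {l : ℕ} {t b : ℕ → ℝ} {e : ℕ → stableComponents F}
    (h : IsStableEnumeration F l t b e) {x : ℝ} (hx : x ∈ Icc (t 0) (t 0 + 1)) :
    ∃ k, Phi F (t k) + VReal F (t k) x ≤ Phi F x := by
  obtain ⟨c, hc, hcx⟩ := h.exists_between hx
  obtain ⟨p, hp, hpos, hneg⟩ := h.exists_peak hF hfin hc
  obtain ⟨z, hz, ez, -⟩ := exists_Phi_eq hF x
  have h0c := h.mono c.zero_le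
  have hc1 := h.succ_le hc
  have hPp := primPos_eq_of_nonpos hF hp.2 hneg
  have hNp := primNeg_eq_of_nonneg hF hp.1 hpos
  have hS := primPos_sub_primNeg hF
  have hSp := S_add_one hF p
  rcases le_total x p with hxp | hxp
  · have hNx : primNeg F (t c) = primNeg F x := primNeg_eq_of_nonneg hF hcx.1
      fun s hs => hpos s ⟨hs.1, hs.2.trans_le hxp⟩
    rcases le_or_gt z (t c + 1) with hzc | hzc
    · refine ⟨c, ?_⟩
      have h1 := Phi_le hF (x := t c) (y := z) ⟨hcx.1.trans hz.1, hzc⟩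
      rw [VReal_of_le hF hcx.1]
      linarith [hS x, hS (t c)]
    · refine ⟨c + 1, ?_⟩
      have h1 := Phi_le hF (x := t (c + 1)) (y := p + 1)
        ⟨by linarith [hp.1], by linarith [hp.2]⟩
      have h2 := S_add_one hF (z - 1)
      rw [sub_add_cancel] at h2
      have h3 := S_le_of_nonneg hF (u := z - 1) (v := x) (by linarith [hz.2])
        fun s hs => hpos s ⟨by linarith [hs.1], hs.2.trans_le hxp⟩
      rw [VReal_of_ge hF hcx.2]
      linarith [hS p, hS (t (c + 1))]
  · have hPx : primPos F x = primPos F (t (c + 1)) := primPos_eq_of_nonpos hF hcx.2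
      fun s hs => hneg s ⟨hxp.trans_lt hs.1, hs.2⟩
    rcases le_or_gt (t (c + 1)) z with hzc | hzc
    · refine ⟨c + 1, ?_⟩
      have h1 := Phi_le hF (x := t (c + 1)) (y := z) ⟨hzc, by linarith [hz.2, hcx.2]⟩
      rw [VReal_of_ge hF hcx.2]
      linarith [hS x, hS (t (c + 1))]
    · refine ⟨c, ?_⟩
      have h1 := Phi_le hF (x := t c) (y := p) ⟨hp.1, by linarith [hp.2]⟩
      have h3 := S_le_of_nonpos hF hz.1
        fun s hs => hneg s ⟨hxp.trans_lt hs.1, hs.2.trans hzc⟩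
      rw [VReal_of_le hF hcx.1]
      linarith [hS p, hS (t c)]

theorem monotone_or_antitone_of_stableComponents_eq_empty (hF : Continuous F)
    (hfin : (zeroComponents F).Finite) (h : stableComponents F = ∅) :
    Monotone (S F) ∨ Antitone (S F) := by
  have hno : ∀ x y : ℝ, F (x : UnitAddCircle) < 0 → 0 < F (y : UnitAddCircle) → False := by
    intro x y hx hy
    have h1 := Int.lt_floor_add_one (x - y)
    rw [← coe_add_int y (⌊x - y⌋ + 1)] at hy
    obtain ⟨a, b, -, -, hab⟩ := exists_isStableInterval_between hF hfin
      (by push_cast; linarith) hx hy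
    have := hab.mem_stableComponents
    rw [h] at this
    exact this
  by_cases hneg : ∃ x : ℝ, F (x : UnitAddCircle) < 0
  · obtain ⟨x, hx⟩ := hneg
    exact Or.inr fun u v huv => S_le_of_nonpos hF huv fun s _ => not_lt.1 (hno x s hx)
  · push Not at hneg
    exact Or.inl fun u v huv => S_le_of_nonneg hF huv fun s _ => hneg s

theorem exists_W_eq_Phi_add (hF : Continuous F) (hfin : (zeroComponents F).Finite) :
    ∃ κ : ℝ, ∀ x : ℝ, W F (x : UnitAddCircle) = Phi F x + κ := by
  by_cases hemp : stableComponents F = ∅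
  · refine ⟨-min 0 (-S F 1), fun x => ?_⟩
    rw [Phi_eq_of_monotone_or_antitone hF
      (monotone_or_antitone_of_stableComponents_eq_empty hF hfin hemp), W, if_pos hemp]
    ring
  · refine ⟨primPos F 1, fun x => ?_⟩
    rw [W, if_neg hemp]
    have hne := nonempty_iff_ne_empty.2 hemp
    have : Nonempty (stableComponents F) := hne.to_subtype
    have : Finite (stableComponents F) := (finite_stableComponents hfin).to_subtype
    refine le_antisymm ?_ (le_ciInf fun K => ?_)
    · obtain ⟨C, hC⟩ := hne
      obtain ⟨a, b, -, hab⟩ := exists_isStableInterval hC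
      -- The enumeration is started in [x-1, x), so that `x` lies between `t 0` and `t 0 + 1`.
      obtain ⟨k, hk⟩ := exists_add_int_mem_Ico a (x - 1)
      obtain ⟨l, t, b', e, he, ht0⟩ := exists_isStableEnumeration hfin (hab.add_int k)
      obtain ⟨j, hj⟩ := he.exists_Phi_add_VReal_le hF hfin (x := x)
        ⟨by linarith [hk.2], by linarith [hk.1]⟩
      refine (ciInf_le (finite_range _).bddBelow (e j)).trans ?_
      rw [WComp_eq hF hfin (e j) (he.interval j) (he.coe_eq j)]
      have h1 := VSet_le hF (A := (e j : Set UnitAddCircle)) (x := (t j : UnitAddCircle))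
        (by
          rw [he.coe_eq]
          exact ⟨t j, ⟨le_rfl, (he.interval j).le⟩, rfl⟩) (mem_singleton (x : UnitAddCircle))
      have h2 := V_coe_le_VReal hF (t j) x
      linarith
    · obtain ⟨a, b, hK, hab⟩ := exists_isStableInterval K.2
      rw [WComp_eq hF hfin K hab hK, hK]
      linarith [hab.Phi_le_Phi_add_VSet hF x]

end CircleLD

theorem mainTheorem1 (F : UnitAddCircle → ℝ) (hF : Continuous F) :
    -- Part (i)
    ((∃ L : NNReal, LipschitzWith L (CircleLD.Phi F)) ∧
      Function.Periodic (CircleLD.Phi F) 1 ∧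
      ((Monotone (CircleLD.S F) ∨ Antitone (CircleLD.S F)) →
        ∀ x : ℝ, CircleLD.Phi F x = min 0 (-CircleLD.S F 1)) ∧
      (CircleLD.S F 1 = 0 →
        Function.Periodic (CircleLD.S F) 1 ∧
          ∃ c : ℝ, ∀ x : ℝ, CircleLD.Phi F x = CircleLD.S F x + c) ∧
      (CircleLD.S F 1 ≠ 0 → ¬ (Monotone (CircleLD.S F) ∨ Antitone (CircleLD.S F)) →
        IsOpen (CircleLD.U F) ∧
        (interior (CircleLD.U F)ᶜ).Nonempty ∧
        (∀ z ∈ CircleLD.U F, ∃ c : ℝ, ∀ x ∈ connectedComponentIn (CircleLD.U F) z,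
          CircleLD.Phi F x = CircleLD.S F x + c) ∧
        (∀ a b : ℝ, Set.Ioo a b ⊆ CircleLD.U F → ∀ x ∈ Set.Ioo a b,
          CircleLD.Phi F x = CircleLD.S F x - CircleLD.S F a + CircleLD.Phi F a) ∧
        (∀ x ∈ (CircleLD.U F)ᶜ, CircleLD.Phi F x = min 0 (-CircleLD.S F 1)) ∧
        (∀ x ∈ (CircleLD.U F)ᶜ, ∀ y : ℝ, CircleLD.Phi F y ≤ CircleLD.Phi F x) ∧
        IsGreatest (CircleLD.Phi F '' Set.Ici 0) (min 0 (-CircleLD.S F 1)) ∧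
        IsGreatest (CircleLD.Phi F '' Set.Icc 0 1) (min 0 (-CircleLD.S F 1)))) ∧
    -- Part (ii)
    ((CircleLD.zeroComponents F).Finite →
      ∃ mPhi mW : ℝ,
        IsLeast (CircleLD.Phi F '' Set.Icc 0 1) mPhi ∧
        IsLeast (Set.range (CircleLD.W F)) mW ∧
        ∀ x : ℝ, CircleLD.Phi F x - mPhi = CircleLD.W F (x : UnitAddCircle) - mW) := by
  refine ⟨⟨CircleLD.exists_lipschitzWith_Phi hF, CircleLD.Phi_add_one hF,
    CircleLD.Phi_eq_of_monotone_or_antitone hF, fun h => ⟨CircleLD.periodic_S hF h, _,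
      CircleLD.Phi_eq_of_S_one_eq_zero hF h⟩, fun h1 _ => ?_⟩, fun hfin => ?_⟩
  · have hU : ∀ x ∈ (CircleLD.U F)ᶜ, CircleLD.Phi F x = min 0 (-CircleLD.S F 1) :=
      fun x hx => not_not.1 hx
    have hint := CircleLD.nonempty_interior_compl_U hF h1
    obtain ⟨x, hx⟩ := hint.mono interior_subset
    obtain ⟨y, hy, ey⟩ := CircleLD.exists_mem_Ico_Phi_eq hF x 0
    rw [zero_add] at hy
    have hub : ∀ A : Set ℝ, min 0 (-CircleLD.S F 1) ∈ upperBounds (CircleLD.Phi F '' A) := by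
      rintro A _ ⟨z, -, rfl⟩
      exact CircleLD.Phi_le_min hF z
    exact ⟨CircleLD.isOpen_U hF, hint,
      fun z _ => CircleLD.Phi_eq_on_connectedComponentIn_U hF h1 z,
      fun a b hab x hx => CircleLD.Phi_eq_of_Ioo_subset_U hF h1 hab hx, hU,
      fun x hx z => (CircleLD.Phi_le_min hF z).trans_eq (hU x hx).symm,
      ⟨⟨y, hy.1, ey.trans (hU x hx)⟩, hub _⟩, ⟨⟨y, ⟨hy.1, hy.2.le⟩, ey.trans (hU x hx)⟩, hub _⟩⟩
  · obtain ⟨κ, hκ⟩ := CircleLD.exists_W_eq_Phi_add hF hfin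
    obtain ⟨m, hm, hmin⟩ := isCompact_Icc.exists_isMinOn (Set.nonempty_Icc.2 (zero_le_one' ℝ))
      (CircleLD.continuous_Phi hF).continuousOn
    refine ⟨CircleLD.Phi F m, CircleLD.Phi F m + κ, ⟨⟨m, hm, rfl⟩, ?_⟩, ⟨⟨m, hκ m⟩, ?_⟩,
      fun x => by rw [hκ]; ring⟩
    · rintro _ ⟨x, hx, rfl⟩
      exact hmin hx
    · rintro _ ⟨z, rfl⟩
      induction z using QuotientAddGroup.induction_on with | H x =>
      obtain ⟨y, hy, ey⟩ := CircleLD.exists_mem_Ico_Phi_eq hF x 0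
      rw [zero_add] at hy
      have h1 : CircleLD.Phi F m ≤ CircleLD.Phi F y := hmin ⟨hy.1, hy.2.le⟩
      change _ ≤ CircleLD.W F (x : UnitAddCircle)
      rw [hκ]
      linarith
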